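/- Let $K$ be a field. A proartinian Hopf algebra over $K$ is a topological $K$-vector space $H$ ($K$ discrete) with a base $\Lambda_H$ of neighbourhoods of $0$ consisting of open subspaces $U$, and finite-dimensional Hopf algebra structures on all $H/U$ ($U\in\Lambda_H$) such that the natural maps $H/U\to H/V$ for $U\subseteq V$ are Hopf algebra morphisms and $H=\varprojlim_U H/U$; it gets its multiplication from this limit. A morphism $H\to H'$ of such objects is a linear map $f$ such that for each $U'\in\Lambda_{H'}$ there is $U\in\Lambda_H$ for which $f$ induces a morphism of Hopf algebras $H/U\to H'/U'$. An open proartinian Hopf ideal is an open subspace $I\subseteq H$ whose image in every $H/U$, $U\in\Lambda_H$, is a Hopf ideal; then $H/I$ is a finite-dimensional Hopf algebra. Let $L/K$ be a separable algebraic field extension, of finite or infinite degree, and let $L$ be a discrete left $H$-module algebra. For an open proartinian Hopf ideal $I$ put $L^I=\{x\in L: Ix=0\}$. For a field extension $E/K$ let $E\hat\otimes_K H=\varprojlim_I E\otimes_K H/I$ ($I$ running through the open proartinian Hopf ideals; it is a proartinian Hopf $E$-algebra), and give $\mathrm{Hom}_K(L,E)=\varprojlim_I \mathrm{Hom}_K(L^I,E)$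 the limit topology of the discrete topologies. It is a right $E\hat\otimes_K H$-module by $(f\cdot(y\otimes h))(x)=y f(h\cdot x)$. If $E\supseteq L$, the canonical map $\mathrm{can}_E:E\hat\otimes_K H\to \mathrm{Hom}_K(L,E)$ is given by $\mathrm{can}_E(y\otimes h)(x)=y\,(h\cdot x)$. Assume that $L/K$ is $H$-Galois, i.e. that $\mathrm{can}_L:L\hat\otimes_K H\to\mathrm{End}_K(L)$ is a homeomorphism. Let $\tilde L\supseteq L$ be a normal closure of $L/K$, $G=\mathrm{Gal}(\tilde L/K)$ with its Krull topology and $G'=\mathrm{Gal}(\tilde L/L)$. For an open proartinian Hopf ideal $I$ let $N_I$ be the group of grouplike elements of the Hopf $\tilde L$-algebra $\tilde L\otimes_K H/I$. Then: (a) For every open proartinian Hopf ideal $I$, $L^I$ is finite-dimensional over $K$, and the set $\mathrm{Hom}_{K\text{-}\mathrm{Alg}}(L^I,\tilde L)$ is an $\tilde L$-basis of $\mathrm{Hom}_K(L^I,\tilde L)$ and is exactly the set of grouplike elements of this $\tilde L$-coalgebra (whose structure is $f(xy)=f_{(1)}(x)f_{(2)}(y)$, $\varepsilon(f)=f(1)$).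 (b) For every open proartinian Hopf ideal $I$, the group $N_I$ is finite, and the inclusion of $N_I$ induces an isomorphism of Hopf $\tilde L$-algebras $\tilde L[N_I]\cong\tilde L\otimes_K H/I$. (c) The open proartinian Hopf ideals are directed downwards, and with the maps $N_I\to N_J$ ($I\subseteq J$) induced by $H/I\to H/J$ the $N_I$ form a projective system of finite groups; the limit $N=\varprojlim_I N_I$ is a profinite group. (d) There is an isomorphism of proartinian Hopf $\tilde L$-algebras $\tilde L[[N]]\cong\tilde L\hat\otimes_K H$ from the completed group algebra $\tilde L[[N]]=\varprojlim_M\tilde L[N/M]$ ($M$ running through the open normal subgroups of $N$), sending $n\in N$ to the element $(n_I)_I$. The action of $G$ on the first tensor factor induces a continuous left action of $G$ on $N$ by group automorphisms: $(g\cdot n)_I=(g\otimes\mathrm{id})(n_I)$ for all $I$. (e) The canonical map yields a homeomorphism $\beta:N\to G/G'$: for $n\in N$ and $g\in G$, $\beta(n)=gG'$ if and only if $\mathrm{can}_{\tilde L}(n)=g|_L$. (f) The right $\tilde L\hat\otimes_K H$-module structure of $\mathrm{Hom}_K(L,\tilde L)$ yields a continuous right action of $N$ on $G/G'$: for $g,h\in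 G$ and $n\in N$, $(hG')\cdot n=gG'$ if and only if $h|_L\cdot n=g|_L$. It satisfies $$g\cdot\big((hG')\cdot n\big)=(ghG')\cdot(g\cdot n)\qquad(g,h\in G,\ n\in N).$$ Moreover $\beta(mn)=\beta(m)\cdot n$ and $\beta(n)=(1G')\cdot n$ for all $m,n\in N$. (g) For every open proartinian Hopf ideal $I$ there is an open normal subgroup $V\subseteq N$ such that the projection $N\to N_I$ induces an isomorphism $N/V\cong N_I$, and there is an isomorphism of Hopf $\tilde L$-algebras $\tilde L[N/V]\cong\tilde L\otimes_K H/I$ sending the class of $n$ to $n_I$. -/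

import Mathlib

open scoped TensorProduct
open Coalgebra

namespace HopfGalois

/-- A Hopf ideal of a Hopf algebra, as a linear subspace: a two-sided ideal which is a two-sided
coideal and is stable under the antipode. -/
structure IsHopfIdeal {K A : Type*} [Field K] [Ring A] [HopfAlgebra K A]
    (J : Submodule K A) : Prop where
  mul_mem_left : ∀ a x : A, x ∈ J → a * x ∈ J
  mul_mem_right : ∀ a x : A, x ∈ J → x * a ∈ J
  isCoideal : J.IsCoideal
  antipode_mem : ∀ x ∈ J, HopfAlgebra.antipode K x ∈ J

section QuotientHopf

variable {K A B C : Type*} [Field K] [Ring A] [Ring B] [Algebra K B] [Ring C] [Algebra K C]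

/-- Descent of an algebra map along a surjective algebra map. -/
noncomputable def algLift [Algebra K A] (q : A →ₐ[K] B) (hq : Function.Surjective q)
    (g : A →ₐ[K] C) (h : ∀ x, q x = 0 → g x = 0) : B →ₐ[K] C :=
  have key : ∀ x y, q x = q y → g x = g y := fun x y hxy => by
    rw [← sub_eq_zero, ← map_sub]
    exact h _ (by rw [map_sub, hxy, sub_self])
  AlgHom.ofLinearMap
    { toFun := fun b => g (Function.surjInv hq b)
      map_add' := fun x y => by
        rw [← map_add]; apply key; simp [Function.surjInv_eq]
      map_smul' := fun k x => by
        rw [RingHom.id_apply, ← map_smul]; apply key; simp [Function.surjInv_eq] }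
    (by
      rw [← map_one g]; apply key; simp [Function.surjInv_eq])
    (fun x y => by
      change g _ = g _ * g _
      rw [← map_mul]; apply key; simp [Function.surjInv_eq])

theorem algLift_apply [Algebra K A] (q : A →ₐ[K] B) (hq : Function.Surjective q)
    (g : A →ₐ[K] C) (h : ∀ x, q x = 0 → g x = 0) (a : A) : algLift q hq g h (q a) = g a := by
  have e : q (Function.surjInv hq (q a)) = q a := Function.surjInv_eq hq (q a)
  change g _ = g _
  rw [← sub_eq_zero, ← map_sub]
  exact h _ (by rw [map_sub, e, sub_self])

variable [HopfAlgebra K A]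

theorem map_comul_eq_zero {q : A →ₐ[K] B} (hJ : IsHopfIdeal (LinearMap.ker q.toLinearMap))
    (x : A) (hx : q x = 0) :
    TensorProduct.map q.toLinearMap q.toLinearMap (comul (R := K) x) = 0 := by
  have h := hJ.isCoideal.map_mkQ_comul_eq_zero (x := x) (by simpa using hx)
  have e : q.toLinearMap = ((LinearMap.ker q.toLinearMap).liftQ q.toLinearMap le_rfl) ∘ₗ
      (LinearMap.ker q.toLinearMap).mkQ := by
    ext; rfl
  have h2 := congrArg (TensorProduct.map
    ((LinearMap.ker q.toLinearMap).liftQ q.toLinearMap le_rfl)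
    ((LinearMap.ker q.toLinearMap).liftQ q.toLinearMap le_rfl)) h
  rwa [← LinearMap.comp_apply, ← TensorProduct.map_comp, ← e, map_zero] at h2

/-- The comultiplication on the image of a surjective algebra map whose kernel is a Hopf ideal. -/
noncomputable def comulOfSurjective (q : A →ₐ[K] B) (hq : Function.Surjective q)
    (hJ : IsHopfIdeal (LinearMap.ker q.toLinearMap)) : B →ₐ[K] B ⊗[K] B :=
  algLift q hq ((Algebra.TensorProduct.map q q).comp (Bialgebra.comulAlgHom K A))
    (fun x hx => map_comul_eq_zero hJ x hx)

/-- The counit on the image of a surjective algebra map whose kernel is a Hopf ideal. -/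
noncomputable def counitOfSurjective (q : A →ₐ[K] B) (hq : Function.Surjective q)
    (hJ : IsHopfIdeal (LinearMap.ker q.toLinearMap)) : B →ₐ[K] K :=
  algLift q hq (Bialgebra.counitAlgHom K A) (fun _ hx => hJ.isCoideal.counit_eq_zero hx)

theorem comulOfSurjective_comp (q : A →ₐ[K] B) (hq : Function.Surjective q)
    (hJ : IsHopfIdeal (LinearMap.ker q.toLinearMap)) :
    (comulOfSurjective q hq hJ).toLinearMap ∘ₗ q.toLinearMap =
      TensorProduct.map q.toLinearMap q.toLinearMap ∘ₗ comul := by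
  ext x
  exact algLift_apply q hq ((Algebra.TensorProduct.map q q).comp (Bialgebra.comulAlgHom K A))
    (fun x hx => map_comul_eq_zero hJ x hx) x

theorem counitOfSurjective_comp (q : A →ₐ[K] B) (hq : Function.Surjective q)
    (hJ : IsHopfIdeal (LinearMap.ker q.toLinearMap)) :
    (counitOfSurjective q hq hJ).toLinearMap ∘ₗ q.toLinearMap = counit := by
  ext x
  exact algLift_apply q hq (Bialgebra.counitAlgHom K A)
    (fun _ hx => hJ.isCoideal.counit_eq_zero hx) x

/-- The antipode on the image of a surjective algebra map whose kernel is a Hopf ideal. -/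
noncomputable def antipodeOfSurjective (q : A →ₐ[K] B) (hq : Function.Surjective q)
    (hJ : IsHopfIdeal (LinearMap.ker q.toLinearMap)) : B →ₗ[K] B :=
  ((LinearMap.ker q.toLinearMap).liftQ (q.toLinearMap ∘ₗ HopfAlgebra.antipode K)
    (fun x hx => hJ.antipode_mem x hx)) ∘ₗ
      (q.toLinearMap.quotKerEquivOfSurjective hq).symm.toLinearMap

theorem antipodeOfSurjective_comp (q : A →ₐ[K] B) (hq : Function.Surjective q)
    (hJ : IsHopfIdeal (LinearMap.ker q.toLinearMap)) :
    antipodeOfSurjective q hq hJ ∘ₗ q.toLinearMap = q.toLinearMap ∘ₗ HopfAlgebra.antipode K := by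
  ext x
  have e : (q.toLinearMap.quotKerEquivOfSurjective hq).symm (q.toLinearMap x) =
      (LinearMap.ker q.toLinearMap).mkQ x := by
    rw [LinearEquiv.symm_apply_eq]; rfl
  simp only [antipodeOfSurjective, LinearMap.comp_apply, LinearEquiv.coe_coe, e]
  rfl

/-- The bialgebra structure on the image of a surjective algebra map whose kernel is a Hopf
ideal. -/
noncomputable abbrev bialgebraOfSurjective (q : A →ₐ[K] B) (hq : Function.Surjective q)
    (hJ : IsHopfIdeal (LinearMap.ker q.toLinearMap)) : Bialgebra K B :=
  Bialgebra.ofAlgHom (comulOfSurjective q hq hJ) (counitOfSurjective q hq hJ)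
  (by
    refine AlgHom.toLinearMap_injective ((LinearMap.cancel_right
      (show Function.Surjective q.toLinearMap from hq)).1 ?_)
    simp only [coassoc_simps, AlgHom.comp_toLinearMap, Algebra.TensorProduct.toLinearMap_map,
        comulOfSurjective_comp]
    simp [coassoc_simps])
  (by
    refine AlgHom.toLinearMap_injective ((LinearMap.cancel_right
      (show Function.Surjective q.toLinearMap from hq)).1 ?_)
    simp only [coassoc_simps, AlgHom.comp_toLinearMap, Algebra.TensorProduct.toLinearMap_map,
        comulOfSurjective_comp, counitOfSurjective_comp]
    rw [CoassocSimps.map_counit_comp_comul_left]; rfl)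
  (by
    refine AlgHom.toLinearMap_injective ((LinearMap.cancel_right
      (show Function.Surjective q.toLinearMap from hq)).1 ?_)
    simp only [coassoc_simps, AlgHom.comp_toLinearMap, Algebra.TensorProduct.toLinearMap_map,
        comulOfSurjective_comp, counitOfSurjective_comp]
    rw [CoassocSimps.map_counit_comp_comul_right]; rfl)

/-- The Hopf algebra structure on the image of a surjective algebra map whose kernel is a Hopf
ideal; it is the only one for which the given map is a morphism of Hopf algebras. -/
noncomputable abbrev hopfOfSurjective (q : A →ₐ[K] B) (hq : Function.Surjective q)
    (hJ : IsHopfIdeal (LinearMap.ker q.toLinearMap)) : HopfAlgebra K B :=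
  letI : Bialgebra K B := bialgebraOfSurjective q hq hJ
  letI : HopfAlgebraStruct K B := { antipode := antipodeOfSurjective q hq hJ }
  HopfAlgebra.ofSurjective (A := A) (B := B) (BialgHom.ofAlgHom q
    (AlgHom.toLinearMap_injective (counitOfSurjective_comp q hq hJ))
    (AlgHom.toLinearMap_injective (comulOfSurjective_comp q hq hJ).symm)) hq
    (antipodeOfSurjective_comp q hq hJ)

end QuotientHopf

/-- Morphisms of bialgebras between Hopf algebras commute with the antipodes. -/
theorem map_antipode {K A C : Type*} [Field K] [Ring A] [HopfAlgebra K A] [Ring C]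
    [HopfAlgebra K C] (t : A →ₐc[K] C) (a : A) :
    t (HopfAlgebra.antipode K a) = HopfAlgebra.antipode K (t a) := by
  let t₀ : A →ₗ[K] C := t.toCoalgHom.toLinearMap
  have h : WithConv.toConv (t₀ ∘ₗ HopfAlgebra.antipode K) =
      WithConv.toConv (HopfAlgebra.antipode K ∘ₗ t₀) := by
    refine left_inv_eq_right_inv (a := WithConv.toConv t₀) ?_ ?_
    · apply WithConv.ofConv_injective
      have := LinearMap.algHom_comp_convMul_distrib (AlgHomClass.toAlgHom t)
        (WithConv.toConv (HopfAlgebra.antipode K)) (WithConv.toConv (LinearMap.id (R := K) (M := A)))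
      rw [LinearMap.antipode_mul_id, LinearMap.algHom_comp_convOne] at this
      exact this.symm
    · apply WithConv.ofConv_injective
      have := LinearMap.convMul_comp_coalgHom_distrib
        (WithConv.toConv (LinearMap.id (R := K) (M := C)))
        (WithConv.toConv (HopfAlgebra.antipode K)) t.toCoalgHom
      rw [LinearMap.id_mul_antipode, LinearMap.convOne_comp_coalgHom] at this
      exact this.symm
  exact LinearMap.congr_fun (WithConv.toConv_injective h) a

/-- An algebra map whose composition with a surjective bialgebra map is a bialgebra map is a
bialgebra map. -/
theorem exists_bialgHom {K A B C : Type*} [Field K] [Ring A] [HopfAlgebra K A] [Ring B]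
    [HopfAlgebra K B] [Ring C] [HopfAlgebra K C] (s : A →ₐc[K] B) (hs : Function.Surjective s)
    (t : A →ₐc[K] C) (f : B →ₐ[K] C) (h : ∀ a, f (s a) = t a) :
    ∃ g : B →ₐc[K] C, ∀ b, g b = f b := by
  have hl : f.toLinearMap ∘ₗ s.toCoalgHom.toLinearMap = t.toCoalgHom.toLinearMap :=
    LinearMap.ext h
  refine ⟨BialgHom.ofAlgHom f ?_ ?_, fun b => rfl⟩
  · ext b
    obtain ⟨a, rfl⟩ := hs b
    change counit (R := K) (f (s a)) = counit (R := K) (s a)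
    rw [h, CoalgHomClass.counit_comp_apply, CoalgHomClass.counit_comp_apply]
  · ext b
    obtain ⟨a, rfl⟩ := hs b
    change TensorProduct.map f.toLinearMap f.toLinearMap (comul (R := K) (s a)) =
      comul (R := K) (f (s a))
    rw [h, ← CoalgHomClass.map_comp_comul_apply, ← CoalgHomClass.map_comp_comul_apply]
    change TensorProduct.map f.toLinearMap f.toLinearMap
      (TensorProduct.map s.toCoalgHom.toLinearMap s.toCoalgHom.toLinearMap (comul (R := K) a)) =
      TensorProduct.map t.toCoalgHom.toLinearMap t.toCoalgHom.toLinearMap (comul (R := K) a)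
    rw [← LinearMap.comp_apply, ← TensorProduct.map_comp, hl]

universe u v w w'

set_option linter.checkUnivs false in
/-- A proartinian Hopf algebra over `K` (with `K` discrete): a topological vector space `H` with a
base of neighbourhoods of `0` consisting of open subspaces `U`, together with finite dimensional
Hopf algebra structures on the quotients `H / U`, compatible with the projections
`H / U → H / V`, such that `H` is the projective limit of these quotients. The subspaces `U` are
presented as the kernels of surjections `π i : H → A i` onto finite dimensional Hopf algebras. The
multiplication of `H` is the one for which all the projections are algebra maps. -/
structure ProartinianHopf (K : Type u) (H : Type v) [Field K] [Ring H] [Algebra K H]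
    [TopologicalSpace H] where
  /-- the index set of the base of neighbourhoods -/
  ι : Type w
  /-- the quotients `H / U` -/
  A : ι → Type w'
  [ring : ∀ i, Ring (A i)]
  [hopf : ∀ i, HopfAlgebra K (A i)]
  /-- the projections `H → H / U` -/
  π : ∀ i, H →ₐ[K] A i
  isTopologicalAddGroup : IsTopologicalAddGroup H
  surjective : ∀ i, Function.Surjective (π i)
  isOpen_ker : ∀ i, IsOpen {h : H | π i h = 0}
  hasBasis : (nhds (0 : H)).HasBasis (fun _ : ι => True) (fun i => {h : H | π i h = 0})
  finite : ∀ i, Module.Finite K (A i)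
  /-- if `U ⊆ V`, the natural map `H / U → H / V` is a morphism of Hopf algebras -/
  transition : ∀ i j, (∀ h, π i h = 0 → π j h = 0) →
    ∃ t : A i →ₐc[K] A j, ∀ h, t (π i h) = π j h
  /-- the natural map from `H` to the projective limit of the `H / U` is bijective -/
  complete : ∀ x : (∀ i, A i),
    (∀ i j, (∀ h, π i h = 0 → π j h = 0) → ∀ h, π i h = x i → π j h = x j) →
    ∃! h, ∀ i, π i h = x i

attribute [instance] ProartinianHopf.ring ProartinianHopf.hopf

/-- A morphism of proartinian Hopf algebras: a linear map `f : H → H'` such that every projection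
`H' → H' / U'` composed with `f` factors through a morphism of Hopf algebras `H / U → H' / U'` for
some `U`. -/
def ProartinianHopf.IsMorphism {K : Type*} {H H' : Type*} [Field K] [Ring H] [Algebra K H]
    [TopologicalSpace H] [Ring H'] [Algebra K H'] [TopologicalSpace H']
    (P : ProartinianHopf K H) (P' : ProartinianHopf K H') (f : H →ₗ[K] H') : Prop :=
  ∀ i' : P'.ι, ∃ (i : P.ι) (t : P.A i →ₐc[K] P'.A i'), ∀ h, t (P.π i h) = P'.π i' (f h)

namespace ProartinianHopf

section OpenIdeals

variable {K : Type u} {H : Type v} [Field K] [Ring H] [Algebra K H] [TopologicalSpace H]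
  (P : ProartinianHopf K H)

/-- A proartinian Hopf ideal: a subspace whose image in each `H / U` is a Hopf ideal. -/
def IsProartinianHopfIdeal (I : Submodule K H) : Prop :=
  ∀ i, IsHopfIdeal (I.map (P.π i).toLinearMap)

/-- The open proartinian Hopf ideals of `H`. -/
structure OpenHopfIdeal where
  toSubmodule : Submodule K H
  isOpen : IsOpen (toSubmodule : Set H)
  isHopfIdeal : P.IsProartinianHopfIdeal toSubmodule

variable {P}

instance : LE P.OpenHopfIdeal := ⟨fun I J => I.toSubmodule ≤ J.toSubmodule⟩

theorem exists_le (s : Set H) (hs : s ∈ nhds (0 : H)) : ∃ i, ∀ h, P.π i h = 0 → h ∈ s := by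
  obtain ⟨i, -, hi⟩ := P.hasBasis.mem_iff.1 hs
  exact ⟨i, fun h hh => hi hh⟩

theorem exists_le_le (i j : P.ι) :
    ∃ k, (∀ h, P.π k h = 0 → P.π i h = 0) ∧ (∀ h, P.π k h = 0 → P.π j h = 0) := by
  obtain ⟨k, hk⟩ := P.exists_le ({h : H | P.π i h = 0} ∩ {h : H | P.π j h = 0})
    (Filter.inter_mem (P.hasBasis.mem_of_mem trivial) (P.hasBasis.mem_of_mem trivial))
  exact ⟨k, fun h hh => (hk h hh).1, fun h hh => (hk h hh).2⟩

/-- The kernels of the projections `π i` are open proartinian Hopf ideals. -/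
def kerIdeal (i : P.ι) : P.OpenHopfIdeal where
  toSubmodule := LinearMap.ker (P.π i).toLinearMap
  isOpen := P.isOpen_ker i
  isHopfIdeal := fun j => by
    obtain ⟨k, hki, hkj⟩ := P.exists_le_le i j
    obtain ⟨s, hs⟩ := P.transition k i hki
    obtain ⟨t, ht⟩ := P.transition k j hkj
    have mem : ∀ a : P.A k, s a = 0 →
        t a ∈ (LinearMap.ker (P.π i).toLinearMap).map (P.π j).toLinearMap := by
      intro a ha
      obtain ⟨h, rfl⟩ := P.surjective k a
      exact ⟨h, by simpa [hs] using ha, (ht h).symm⟩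
    have mem' : ∀ b ∈ (LinearMap.ker (P.π i).toLinearMap).map (P.π j).toLinearMap,
        ∃ a, s a = 0 ∧ t a = b := by
      rintro _ ⟨h, hh, rfl⟩
      exact ⟨P.π k h, by rw [hs]; exact hh, ht h⟩
    have surj : ∀ b, ∃ a, t a = b := by
      intro b
      obtain ⟨h, rfl⟩ := P.surjective j b
      exact ⟨P.π k h, ht h⟩
    refine ⟨?_, ?_, ⟨?_, ?_⟩, ?_⟩
    · intro b x hx
      obtain ⟨a, ha, rfl⟩ := mem' x hx
      obtain ⟨c, rfl⟩ := surj b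
      rw [← map_mul]
      exact mem _ (by rw [map_mul, ha, mul_zero])
    · intro b x hx
      obtain ⟨a, ha, rfl⟩ := mem' x hx
      obtain ⟨c, rfl⟩ := surj b
      rw [← map_mul]
      exact mem _ (by rw [map_mul, ha, zero_mul])
    · intro x hx
      obtain ⟨a, ha, rfl⟩ := mem' x hx
      rw [CoalgHomClass.counit_comp_apply, ← CoalgHomClass.counit_comp_apply s, ha, map_zero]
    · intro x hx
      obtain ⟨a, ha, rfl⟩ := mem' x hx
      set J := (LinearMap.ker (P.π i).toLinearMap).map (P.π j).toLinearMap
      let s₀ : P.A k →ₗ[K] P.A i := s.toCoalgHom.toLinearMap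
      let t₀ : P.A k →ₗ[K] P.A j := t.toCoalgHom.toLinearMap
      have hle : LinearMap.ker s₀ ≤ LinearMap.ker (J.mkQ ∘ₗ t₀) := by
        intro y hy
        rw [LinearMap.mem_ker, LinearMap.comp_apply, Submodule.mkQ_apply,
          Submodule.Quotient.mk_eq_zero]
        exact mem y hy
      obtain ⟨r, hr⟩ := LinearMap.exists_leftInverse_of_injective
        ((LinearMap.ker s₀).liftQ s₀ le_rfl) (LinearMap.ker_eq_bot.2
          (LinearMap.ker_eq_bot.1 (Submodule.ker_liftQ_eq_bot _ _ _ le_rfl)))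
      let g : P.A i →ₗ[K] (P.A j ⧸ J) := (LinearMap.ker s₀).liftQ (J.mkQ ∘ₗ t₀) hle ∘ₗ r
      have hg : g ∘ₗ s₀ = J.mkQ ∘ₗ t₀ := by
        ext y
        have := LinearMap.congr_fun hr ((LinearMap.ker s₀).mkQ y)
        simp only [LinearMap.comp_apply, Submodule.mkQ_apply, Submodule.liftQ_apply,
          LinearMap.id_apply] at this
        simp only [g, LinearMap.comp_apply, this]
        rfl
      have h1 : comul (R := K) (t a) = TensorProduct.map t₀ t₀ (comul a) :=
        (CoalgHomClass.map_comp_comul_apply t a).symm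
      have h2 : TensorProduct.map s₀ s₀ (comul (R := K) a) = 0 := by
        have := CoalgHomClass.map_comp_comul_apply (R := K) s a
        rw [ha, map_zero] at this
        exact this
      rw [h1, ← LinearMap.comp_apply, ← TensorProduct.map_comp, ← hg, TensorProduct.map_comp,
        LinearMap.comp_apply, h2, map_zero]
    · intro x hx
      obtain ⟨a, ha, rfl⟩ := mem' x hx
      rw [← map_antipode]
      exact mem _ (by rw [map_antipode, ha, map_zero])

namespace OpenHopfIdeal

theorem exists_ker_le (I : P.OpenHopfIdeal) : ∃ i, ∀ h, P.π i h = 0 → h ∈ I.toSubmodule :=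
  P.exists_le _ (I.isOpen.mem_nhds I.toSubmodule.zero_mem)

theorem mem_iff (I : P.OpenHopfIdeal) {i : P.ι} (hi : ∀ h, P.π i h = 0 → h ∈ I.toSubmodule)
    (h : H) : P.π i h ∈ I.toSubmodule.map (P.π i).toLinearMap ↔ h ∈ I.toSubmodule := by
  constructor
  · rintro ⟨y, hy, hyx⟩
    have : h - y ∈ I.toSubmodule := hi _ (by
      rw [map_sub, sub_eq_zero]; exact hyx.symm)
    simpa using I.toSubmodule.add_mem this hy
  · intro hh
    exact ⟨h, hh, rfl⟩

/-- An open proartinian Hopf ideal is an ideal. -/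
def toIdeal (I : P.OpenHopfIdeal) : Ideal H where
  carrier := I.toSubmodule
  add_mem' := I.toSubmodule.add_mem
  zero_mem' := I.toSubmodule.zero_mem
  smul_mem' := fun a x hx => by
    obtain ⟨i, hi⟩ := I.exists_ker_le
    refine (I.mem_iff hi _).1 ?_
    rw [smul_eq_mul, map_mul]
    exact (I.isHopfIdeal i).mul_mem_left _ _ ((I.mem_iff hi _).2 hx)

instance (I : P.OpenHopfIdeal) : I.toIdeal.IsTwoSided where
  mul_mem_of_left := fun {a} b ha => by
    obtain ⟨i, hi⟩ := I.exists_ker_le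
    refine (I.mem_iff hi _).1 ?_
    rw [map_mul]
    exact (I.isHopfIdeal i).mul_mem_right _ _ ((I.mem_iff hi _).2 ha)

/-- The quotient `H / I` by an open proartinian Hopf ideal. -/
def Quot (I : P.OpenHopfIdeal) : Type v := H ⧸ I.toIdeal

noncomputable instance (I : P.OpenHopfIdeal) : Ring I.Quot :=
  inferInstanceAs (Ring (H ⧸ I.toIdeal))

/-- The algebra structure of `H / I`. -/
noncomputable abbrev quotAlgebra (I : P.OpenHopfIdeal) : Algebra K I.Quot :=
  inferInstanceAs (Algebra K (H ⧸ I.toIdeal))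

section

attribute [local instance] quotAlgebra

/-- The projection `H → H / I` as an algebra map, auxiliary version. -/
noncomputable def mkAux (I : P.OpenHopfIdeal) : H →ₐ[K] I.Quot :=
  Ideal.Quotient.mkₐ K I.toIdeal

theorem mkAux_surjective (I : P.OpenHopfIdeal) : Function.Surjective I.mkAux :=
  Ideal.Quotient.mk_surjective

theorem mkAux_eq_zero (I : P.OpenHopfIdeal) (h : H) : I.mkAux h = 0 ↔ h ∈ I.toSubmodule :=
  Ideal.Quotient.eq_zero_iff_mem

/-- The projection `H / U → H / I` for `U ⊆ I`, auxiliary version. -/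
noncomputable def projAux (I : P.OpenHopfIdeal) (i : P.ι)
    (hi : ∀ h, P.π i h = 0 → h ∈ I.toSubmodule) : P.A i →ₐ[K] I.Quot :=
  algLift (P.π i) (P.surjective i) I.mkAux (fun h hh => (I.mkAux_eq_zero h).2 (hi h hh))

theorem projAux_π (I : P.OpenHopfIdeal) (i : P.ι)
    (hi : ∀ h, P.π i h = 0 → h ∈ I.toSubmodule) (h : H) :
    I.projAux i hi (P.π i h) = I.mkAux h :=
  algLift_apply (P.π i) (P.surjective i) I.mkAux (fun h hh => (I.mkAux_eq_zero h).2 (hi h hh)) h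

theorem projAux_surjective (I : P.OpenHopfIdeal) (i : P.ι)
    (hi : ∀ h, P.π i h = 0 → h ∈ I.toSubmodule) : Function.Surjective (I.projAux i hi) := by
  intro b
  obtain ⟨h, rfl⟩ := I.mkAux_surjective b
  exact ⟨_, I.projAux_π i hi h⟩

theorem ker_projAux (I : P.OpenHopfIdeal) (i : P.ι)
    (hi : ∀ h, P.π i h = 0 → h ∈ I.toSubmodule) :
    IsHopfIdeal (LinearMap.ker (I.projAux i hi).toLinearMap) := by
  have e : LinearMap.ker (I.projAux i hi).toLinearMap =
      I.toSubmodule.map (P.π i).toLinearMap := by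
    ext a
    obtain ⟨h, rfl⟩ := P.surjective i a
    rw [I.mem_iff hi, LinearMap.mem_ker, ← I.mkAux_eq_zero, ← I.projAux_π i hi]
    rfl
  rw [e]
  exact I.isHopfIdeal i

end

/-- The Hopf algebra structure on `H / I`, as a quotient of `H / U` for a basic open subspace
`U ⊆ I`; it does not depend on `U`, see `ofBasic`. -/
noncomputable instance (I : P.OpenHopfIdeal) : HopfAlgebra K I.Quot :=
  letI := I.quotAlgebra
  hopfOfSurjective (I.projAux I.exists_ker_le.choose I.exists_ker_le.choose_spec)
    (I.projAux_surjective _ _) (I.ker_projAux _ _)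

/-- The projection `H → H / I`. -/
noncomputable def proj (I : P.OpenHopfIdeal) : H →ₐ[K] I.Quot := I.mkAux

theorem proj_surjective (I : P.OpenHopfIdeal) : Function.Surjective I.proj := I.mkAux_surjective

theorem proj_eq_zero (I : P.OpenHopfIdeal) (h : H) : I.proj h = 0 ↔ h ∈ I.toSubmodule :=
  I.mkAux_eq_zero h

/-- The canonical projection `H / U → H / I` for the chosen `U ⊆ I`. -/
noncomputable def projChosen (I : P.OpenHopfIdeal) : P.A I.exists_ker_le.choose →ₐc[K] I.Quot :=
  letI := I.quotAlgebra
  BialgHom.ofAlgHom (I.projAux I.exists_ker_le.choose I.exists_ker_le.choose_spec)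
    (AlgHom.toLinearMap_injective (counitOfSurjective_comp _ (I.projAux_surjective _ _)
      (I.ker_projAux _ _)))
    (AlgHom.toLinearMap_injective (comulOfSurjective_comp _ (I.projAux_surjective _ _)
      (I.ker_projAux _ _)).symm)

theorem projChosen_π (I : P.OpenHopfIdeal) (h : H) :
    I.projChosen (P.π I.exists_ker_le.choose h) = I.proj h :=
  I.projAux_π _ I.exists_ker_le.choose_spec h

theorem exists_ofBasic (I : P.OpenHopfIdeal) (i : P.ι)
    (hi : ∀ h, P.π i h = 0 → h ∈ I.toSubmodule) :
    ∃ f : P.A i →ₐc[K] I.Quot, ∀ h, f (P.π i h) = I.proj h := by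
  obtain ⟨k, hk, hk'⟩ := P.exists_le_le i I.exists_ker_le.choose
  obtain ⟨s, hs⟩ := P.transition k i hk
  obtain ⟨t, ht⟩ := P.transition k _ hk'
  have hf := algLift_apply (P.π i) (P.surjective i) I.proj
    (fun h hh => (I.proj_eq_zero h).2 (hi h hh))
  obtain ⟨g, hg⟩ := exists_bialgHom s (fun b => by
      obtain ⟨h, rfl⟩ := P.surjective i b
      exact ⟨P.π k h, hs h⟩) (I.projChosen.comp t)
    (algLift (P.π i) (P.surjective i) I.proj (fun h hh => (I.proj_eq_zero h).2 (hi h hh)))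
    (fun a => by
      obtain ⟨h, rfl⟩ := P.surjective k a
      rw [hs, BialgHom.comp_apply, ht, projChosen_π]
      exact hf h)
  exact ⟨g, fun h => (hg _).trans (hf h)⟩

/-- The natural map `H / U → H / I` is a morphism of Hopf algebras for every basic open subspace
`U ⊆ I`. -/
noncomputable def ofBasic (I : P.OpenHopfIdeal) (i : P.ι)
    (hi : ∀ h, P.π i h = 0 → h ∈ I.toSubmodule) : P.A i →ₐc[K] I.Quot :=
  (I.exists_ofBasic i hi).choose

theorem ofBasic_π (I : P.OpenHopfIdeal) (i : P.ι)
    (hi : ∀ h, P.π i h = 0 → h ∈ I.toSubmodule) (h : H) :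
    I.ofBasic i hi (P.π i h) = I.proj h :=
  (I.exists_ofBasic i hi).choose_spec h

theorem finite_quot (I : P.OpenHopfIdeal) : Module.Finite K I.Quot := by
  obtain ⟨i, hi⟩ := I.exists_ker_le
  have := P.finite i
  refine Module.Finite.of_surjective (I.ofBasic i hi).toCoalgHom.toLinearMap ?_
  intro b
  obtain ⟨h, rfl⟩ := I.proj_surjective b
  exact ⟨P.π i h, I.ofBasic_π i hi h⟩

theorem exists_factor {I J : P.OpenHopfIdeal} (hIJ : I ≤ J) :
    ∃ f : I.Quot →ₐc[K] J.Quot, ∀ h, f (I.proj h) = J.proj h := by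
  obtain ⟨i, hi⟩ := I.exists_ker_le
  have hf := algLift_apply I.proj I.proj_surjective J.proj
    (fun h hh => (J.proj_eq_zero h).2 (hIJ ((I.proj_eq_zero h).1 hh)))
  obtain ⟨g, hg⟩ := exists_bialgHom (I.ofBasic i hi) (fun b => by
      obtain ⟨h, rfl⟩ := I.proj_surjective b
      exact ⟨P.π i h, I.ofBasic_π i hi h⟩) (J.ofBasic i (fun h hh => hIJ (hi h hh)))
    (algLift I.proj I.proj_surjective J.proj
      (fun h hh => (J.proj_eq_zero h).2 (hIJ ((I.proj_eq_zero h).1 hh))))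
    (fun a => by
      obtain ⟨h, rfl⟩ := P.surjective i a
      rw [ofBasic_π, ofBasic_π]
      exact hf h)
  exact ⟨g, fun h => (hg _).trans (hf h)⟩

/-- The natural map `H / I → H / J` for `I ⊆ J`, a morphism of Hopf algebras. -/
noncomputable def factor {I J : P.OpenHopfIdeal} (hIJ : I ≤ J) : I.Quot →ₐc[K] J.Quot :=
  (exists_factor hIJ).choose

theorem factor_proj {I J : P.OpenHopfIdeal} (hIJ : I ≤ J) (h : H) :
    factor hIJ (I.proj h) = J.proj h :=
  (exists_factor hIJ).choose_spec h

theorem exists_le (s : Set H) (hs : s ∈ nhds (0 : H)) :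
    ∃ I : P.OpenHopfIdeal, (I.toSubmodule : Set H) ⊆ s := by
  obtain ⟨i, hi⟩ := P.exists_le s hs
  exact ⟨P.kerIdeal i, fun h hh => hi h hh⟩

theorem exists_le_le (I J : P.OpenHopfIdeal) : ∃ M : P.OpenHopfIdeal, M ≤ I ∧ M ≤ J := by
  obtain ⟨M, hM⟩ := exists_le (P := P) ((I.toSubmodule : Set H) ∩ J.toSubmodule)
    (Filter.inter_mem (I.isOpen.mem_nhds I.toSubmodule.zero_mem)
      (J.isOpen.mem_nhds J.toSubmodule.zero_mem))
  exact ⟨M, fun x hx => (hM hx).1, fun x hx => (hM hx).2⟩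

instance : Nonempty P.OpenHopfIdeal :=
  ⟨(exists_le (P := P) Set.univ Filter.univ_mem).choose⟩

theorem le_rfl' (I : P.OpenHopfIdeal) : I ≤ I := fun _ h => h

theorem le_trans' {I J M : P.OpenHopfIdeal} (h : I ≤ J) (h' : J ≤ M) : I ≤ M :=
  fun _ hx => h' (h hx)

end OpenHopfIdeal
end OpenIdeals

section CompletedTensor

variable {K : Type u} {H : Type v} [Field K] [Ring H] [Algebra K H] [TopologicalSpace H]
  (P : ProartinianHopf K H) (E : Type*) [Field E] [Algebra K E]

variable {P} in
/-- The natural map `E ⊗ H / I → E ⊗ H / J` for `I ⊆ J`. -/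
noncomputable def OpenHopfIdeal.baseFactor {I J : P.OpenHopfIdeal} (hIJ : I ≤ J) :
    E ⊗[K] I.Quot →ₐc[E] E ⊗[K] J.Quot :=
  Bialgebra.TensorProduct.map (BialgHom.id E E) (OpenHopfIdeal.factor hIJ)

/-- The completed tensor product of a field extension `E` of `K` with `H`, as a subalgebra of the
product of the `E ⊗ H / I`. -/
noncomputable def completedTensorSubalgebra :
    Subalgebra E (∀ I : P.OpenHopfIdeal, E ⊗[K] I.Quot) where
  carrier := {x | ∀ I J (hIJ : I ≤ J), OpenHopfIdeal.baseFactor E hIJ (x I) = x J}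
  mul_mem' := fun {x y} hx hy I J hIJ => by
    rw [Pi.mul_apply, map_mul, hx I J hIJ, hy I J hIJ]; rfl
  one_mem' := fun I J hIJ => map_one _
  add_mem' := fun {x y} hx hy I J hIJ => by
    rw [Pi.add_apply, map_add, hx I J hIJ, hy I J hIJ]; rfl
  zero_mem' := fun I J hIJ => map_zero _
  algebraMap_mem' := fun r I J hIJ => AlgHomClass.commutes (OpenHopfIdeal.baseFactor E hIJ) r

/-- The completed tensor product of a field extension `E` of `K` with `H`: the projective limit of
the `E ⊗ H / I`, where `I` runs through the open proartinian Hopf ideals of `H`. -/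
noncomputable def CompletedTensor : Type _ := P.completedTensorSubalgebra E

noncomputable instance : Ring (P.CompletedTensor E) :=
  inferInstanceAs (Ring (P.completedTensorSubalgebra E))

noncomputable instance : Algebra E (P.CompletedTensor E) :=
  inferInstanceAs (Algebra E (P.completedTensorSubalgebra E))

namespace CompletedTensor

variable {P E}

/-- The projection to `E ⊗ H / I`. -/
noncomputable def π (I : P.OpenHopfIdeal) : P.CompletedTensor E →ₐ[E] E ⊗[K] I.Quot :=
  (Pi.evalAlgHom E (fun I : P.OpenHopfIdeal => E ⊗[K] I.Quot) I).comp
    (P.completedTensorSubalgebra E).val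

theorem baseFactor_π {I J : P.OpenHopfIdeal} (hIJ : I ≤ J) (x : P.CompletedTensor E) :
    OpenHopfIdeal.baseFactor E hIJ (π I x) = π J x :=
  x.2 I J hIJ

theorem ext {x y : P.CompletedTensor E} (h : ∀ I : P.OpenHopfIdeal, π I x = π I y) : x = y :=
  Subtype.ext (funext h)

/-- The limit topology, where all the `E ⊗ H / I` are discrete. -/
noncomputable instance : TopologicalSpace (P.CompletedTensor E) :=
  ⨅ I : P.OpenHopfIdeal, TopologicalSpace.induced (π I) ⊥

end CompletedTensor
end CompletedTensor
end ProartinianHopf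

/-- For a directed family of maps to discrete spaces, the limit topology. -/
theorem nhds_iInf_induced {ι X : Type*} {Y : ι → Type*} [Nonempty ι] (f : ∀ i, X → Y i) (x : X)
    (hd : ∀ i j, ∃ k, ∀ y, f k y = f k x → f i y = f i x ∧ f j y = f j x) :
    (@nhds X (⨅ i, TopologicalSpace.induced (f i) ⊥) x).HasBasis (fun _ : ι => True)
      (fun i => {y | f i y = f i x}) := by
  have h : @nhds X (⨅ i, TopologicalSpace.induced (f i) ⊥) x =
      ⨅ i, Filter.principal {y | f i y = f i x} := by
    rw [nhds_iInf]
    congr 1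
    ext1 i
    let _ : TopologicalSpace (Y i) := ⊥
    have : DiscreteTopology (Y i) := ⟨rfl⟩
    rw [nhds_induced, nhds_discrete, Filter.comap_pure]
    rfl
  rw [h]
  refine Filter.hasBasis_iInf_principal fun i j => ?_
  obtain ⟨k, hk⟩ := hd i j
  exact ⟨k, fun y hy => (hk y hy).1, fun y hy => (hk y hy).2⟩

theorem isOpen_iInf_induced {ι X : Type*} {Y : ι → Type*} (f : ∀ i, X → Y i) (i : ι) (y : Y i) :
    @IsOpen X (⨅ i, TopologicalSpace.induced (f i) ⊥) {x | f i x = y} := by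
  refine (iInf_le (fun i => TopologicalSpace.induced (f i) ⊥) i) _ ?_
  let _ : TopologicalSpace (Y i) := ⊥
  have : DiscreteTopology (Y i) := ⟨rfl⟩
  exact isOpen_induced (f := f i) (isOpen_discrete {y})

theorem isTopologicalAddGroup_iInf_induced {ι X : Type*} {Y : ι → Type*} {K : Type*} [Field K] [Ring X]
    [Algebra K X] [∀ i, Ring (Y i)] [∀ i, Algebra K (Y i)] (f : ∀ i, X →ₐ[K] Y i) :
    @IsTopologicalAddGroup X (⨅ i, TopologicalSpace.induced (f i) ⊥) _ := by
  refine topologicalAddGroup_iInf fun i => ?_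
  let _ : TopologicalSpace (Y i) := ⊥
  have : DiscreteTopology (Y i) := ⟨rfl⟩
  exact topologicalAddGroup_induced (f i).toLinearMap

namespace ProartinianHopf

section

variable {K : Type u} {H : Type v} [Field K] [Ring H] [Algebra K H] [TopologicalSpace H]
  (P : ProartinianHopf K H) (E : Type*) [Field E] [Algebra K E]

namespace CompletedTensor

variable {P E}

/-- The natural map from the tensor product to the completed tensor product, on pure tensors. -/
noncomputable def tmul (y : E) (h : H) : P.CompletedTensor E :=
  ⟨fun I => y ⊗ₜ[K] I.proj h, fun I J hIJ => by
    simp [OpenHopfIdeal.baseFactor, OpenHopfIdeal.factor_proj]⟩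

theorem π_tmul (I : P.OpenHopfIdeal) (y : E) (h : H) :
    π I (tmul (P := P) y h) = y ⊗ₜ[K] I.proj h := rfl

theorem π_surjective (I : P.OpenHopfIdeal) :
    Function.Surjective (π I : P.CompletedTensor E → E ⊗[K] I.Quot) := by
  intro z
  induction z using TensorProduct.induction_on with
  | zero => exact ⟨0, map_zero _⟩
  | tmul y b =>
    obtain ⟨h, rfl⟩ := I.proj_surjective b
    exact ⟨tmul y h, rfl⟩
  | add x y hx hy =>
    obtain ⟨x, rfl⟩ := hx
    obtain ⟨y, rfl⟩ := hy
    exact ⟨x + y, map_add _ _ _⟩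

theorem le_of_ker_le {I J : P.OpenHopfIdeal}
    (h : ∀ x : P.CompletedTensor E, π I x = 0 → π J x = 0) : I ≤ J := by
  intro x hx
  have h1 := h (tmul 1 x) (by rw [π_tmul, (I.proj_eq_zero x).2 hx, TensorProduct.tmul_zero])
  rw [π_tmul] at h1
  refine (J.proj_eq_zero x).1 ?_
  refine Algebra.TensorProduct.includeRight_injective (R := K) (A := E) (B := J.Quot)
    (algebraMap K E).injective ?_
  rw [map_zero]
  exact h1

end CompletedTensor

/-- The completed tensor product `E ⊗̂ H` is a proartinian Hopf algebra over `E`, with quotients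
`E ⊗ H / I`. -/
noncomputable def completedTensor : ProartinianHopf E (P.CompletedTensor E) where
  ι := P.OpenHopfIdeal
  A := fun I => E ⊗[K] I.Quot
  π := CompletedTensor.π
  isTopologicalAddGroup := isTopologicalAddGroup_iInf_induced
    (fun I : P.OpenHopfIdeal => CompletedTensor.π (E := E) I)
  surjective := CompletedTensor.π_surjective
  isOpen_ker := fun I => isOpen_iInf_induced
    (fun I : P.OpenHopfIdeal => (CompletedTensor.π (E := E) I : _ → _)) I 0
  hasBasis := by
    have := nhds_iInf_induced
      (fun I : P.OpenHopfIdeal => (CompletedTensor.π (E := E) I : _ → _)) 0 (fun I J => by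
        obtain ⟨M, hI, hJ⟩ := OpenHopfIdeal.exists_le_le I J
        refine ⟨M, fun y hy => ?_⟩
        rw [map_zero] at hy
        rw [← CompletedTensor.baseFactor_π hI, ← CompletedTensor.baseFactor_π hJ, hy]
        simp)
    simpa using this
  finite := fun I => by
    have := I.finite_quot
    infer_instance
  transition := fun I J hIJ =>
    ⟨OpenHopfIdeal.baseFactor E (CompletedTensor.le_of_ker_le hIJ),
      fun x => CompletedTensor.baseFactor_π _ x⟩
  complete := fun x hx => by
    have hx' : ∀ I J (hIJ : I ≤ J), OpenHopfIdeal.baseFactor E hIJ (x I) = x J := by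
      intro I J hIJ
      obtain ⟨z, hz⟩ := CompletedTensor.π_surjective I (x I)
      rw [← hz, CompletedTensor.baseFactor_π]
      refine hx I J (fun y hy => ?_) z hz
      rw [← CompletedTensor.baseFactor_π hIJ, hy, map_zero]
    exact ⟨⟨x, hx'⟩, fun I => rfl, fun y hy => CompletedTensor.ext fun I => hy I⟩

/-- The group `N_I` of grouplike elements of the Hopf algebra `E ⊗ H / I`. -/
abbrev groupN (I : P.OpenHopfIdeal) := GroupLike E (E ⊗[K] I.Quot)

variable {P} in
/-- The map `N_I → N_J` for `I ⊆ J`, the restriction of `E ⊗ H / I → E ⊗ H / J`. -/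
noncomputable def groupNMap {I J : P.OpenHopfIdeal} (hIJ : I ≤ J) :
    P.groupN E I →* P.groupN E J where
  toFun := fun n => ⟨OpenHopfIdeal.baseFactor E hIJ n.val, n.2.map _⟩
  map_one' := GroupLike.val_injective (map_one (OpenHopfIdeal.baseFactor E hIJ))
  map_mul' := fun m n => GroupLike.val_injective
    (map_mul (OpenHopfIdeal.baseFactor E hIJ) m.val n.val)

/-- The projective limit of the groups `N_I`, as a subgroup of their product. -/
noncomputable def limNSubgroup : Subgroup (∀ I : P.OpenHopfIdeal, P.groupN E I) where
  carrier := {x | ∀ I J (hIJ : I ≤ J), groupNMap E hIJ (x I) = x J}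
  mul_mem' := fun {x y} hx hy I J hIJ => by
    rw [Pi.mul_apply, map_mul, hx I J hIJ, hy I J hIJ]; rfl
  one_mem' := fun I J hIJ => map_one _
  inv_mem' := fun {x} hx I J hIJ => by
    rw [Pi.inv_apply, map_inv, hx I J hIJ]; rfl

/-- The group `N`, the projective limit of the groups `N_I`. -/
noncomputable def LimN : Type _ := P.limNSubgroup E

noncomputable instance : Group (P.LimN E) := inferInstanceAs (Group (P.limNSubgroup E))

namespace LimN

variable {P E}

/-- The projection `N → N_I`. -/
noncomputable def π (I : P.OpenHopfIdeal) : P.LimN E →* P.groupN E I :=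
  (Pi.evalMonoidHom (fun I : P.OpenHopfIdeal => P.groupN E I) I).comp (P.limNSubgroup E).subtype

/-- The limit topology, where all the `N_I` are discrete. -/
noncomputable instance : TopologicalSpace (P.LimN E) :=
  ⨅ I : P.OpenHopfIdeal, TopologicalSpace.induced (π I) ⊥

/-- The inclusion of `N` in the completed tensor product. -/
noncomputable def toCompletedTensor : P.LimN E →* P.CompletedTensor E where
  toFun := fun n => ⟨fun I => (π I n).val, fun I J hIJ => congrArg GroupLike.val (n.2 I J hIJ)⟩
  map_one' := rfl
  map_mul' := fun _ _ => rfl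

end LimN

end

end ProartinianHopf

/-- The completed group algebra of a topological group `N` over a field `k`, as a subalgebra of the
product of the group algebras of the quotients by the open normal subgroups. -/
noncomputable def completedGroupAlgebraSubalgebra (k N : Type*) [Field k] [Group N]
    [TopologicalSpace N] :
    Subalgebra k (∀ M : OpenNormalSubgroup N, MonoidAlgebra k (N ⧸ M.toSubgroup)) where
  carrier := {x | ∀ (M M' : OpenNormalSubgroup N) (h : M.toSubgroup ≤ M'.toSubgroup),
    MonoidAlgebra.mapDomainBialgHom k (QuotientGroup.map M.toSubgroup M'.toSubgroup
      (MonoidHom.id N) h) (x M) = x M'}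
  mul_mem' := fun {x y} hx hy M M' h => by
    rw [Pi.mul_apply, map_mul, hx M M' h, hy M M' h]; rfl
  one_mem' := fun M M' h => map_one _
  add_mem' := fun {x y} hx hy M M' h => by
    rw [Pi.add_apply, map_add, hx M M' h, hy M M' h]; rfl
  zero_mem' := fun M M' h => map_zero _
  algebraMap_mem' := fun r M M' h => AlgHomClass.commutes (MonoidAlgebra.mapDomainBialgHom k
    (QuotientGroup.map M.toSubgroup M'.toSubgroup (MonoidHom.id N) h)) r

/-- The completed group algebra `k⟦N⟧`: the projective limit of the group algebras `k[N / M]`,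
where `M` runs through the open normal subgroups of `N`. -/
noncomputable def CompletedGroupAlgebra (k N : Type*) [Field k] [Group N]
    [TopologicalSpace N] : Type _ :=
  completedGroupAlgebraSubalgebra k N

namespace CompletedGroupAlgebra

variable {k N : Type*} [Field k] [Group N] [TopologicalSpace N]

noncomputable instance : Ring (CompletedGroupAlgebra k N) :=
  inferInstanceAs (Ring (completedGroupAlgebraSubalgebra k N))

noncomputable instance : Algebra k (CompletedGroupAlgebra k N) :=
  inferInstanceAs (Algebra k (completedGroupAlgebraSubalgebra k N))

/-- The projection to `k[N / M]`. -/
noncomputable def π (M : OpenNormalSubgroup N) :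
    CompletedGroupAlgebra k N →ₐ[k] MonoidAlgebra k (N ⧸ M.toSubgroup) :=
  (Pi.evalAlgHom k (fun M : OpenNormalSubgroup N => MonoidAlgebra k (N ⧸ M.toSubgroup)) M).comp
    (completedGroupAlgebraSubalgebra k N).val

theorem map_π {M M' : OpenNormalSubgroup N} (h : M.toSubgroup ≤ M'.toSubgroup)
    (x : CompletedGroupAlgebra k N) :
    MonoidAlgebra.mapDomainBialgHom k (QuotientGroup.map M.toSubgroup M'.toSubgroup
      (MonoidHom.id N) h) (π M x) = π M' x :=
  x.2 M M' h

theorem ext {x y : CompletedGroupAlgebra k N} (h : ∀ M : OpenNormalSubgroup N, π M x = π M y) :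
    x = y :=
  Subtype.ext (funext h)

/-- The limit topology, where all the `k[N / M]` are discrete. -/
noncomputable instance : TopologicalSpace (CompletedGroupAlgebra k N) :=
  ⨅ M : OpenNormalSubgroup N, TopologicalSpace.induced (π M) ⊥

/-- The inclusion of `N` in the completed group algebra. -/
noncomputable def of (n : N) : CompletedGroupAlgebra k N :=
  ⟨fun M => MonoidAlgebra.of k _ (n : N ⧸ M.toSubgroup), fun _ _ _ =>
    MonoidAlgebra.mapDomainBialgHom_single _ _ _⟩

theorem π_of (M : OpenNormalSubgroup N) (n : N) :
    π M (of n : CompletedGroupAlgebra k N) = MonoidAlgebra.of k _ (n : N ⧸ M.toSubgroup) := rfl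

theorem π_surjective (M : OpenNormalSubgroup N) :
    Function.Surjective (π M : CompletedGroupAlgebra k N → _) := by
  intro z
  induction z using MonoidAlgebra.induction_on with
  | of g =>
    obtain ⟨n, rfl⟩ := QuotientGroup.mk_surjective g
    exact ⟨of n, rfl⟩
  | add x y hx hy =>
    obtain ⟨x, rfl⟩ := hx
    obtain ⟨y, rfl⟩ := hy
    exact ⟨x + y, map_add _ _ _⟩
  | smul r x hx =>
    obtain ⟨x, rfl⟩ := hx
    exact ⟨r • x, map_smul _ _ _⟩

theorem le_of_ker_le {M M' : OpenNormalSubgroup N}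
    (h : ∀ x : CompletedGroupAlgebra k N, π M x = 0 → π M' x = 0) :
    M.toSubgroup ≤ M'.toSubgroup := by
  intro n hn
  have h1 := h (of n - of 1) (by
    rw [map_sub, π_of, π_of, (QuotientGroup.eq_one_iff n).2 hn]; simp)
  rw [map_sub, sub_eq_zero, π_of, π_of] at h1
  have h2 := MonoidAlgebra.of_injective h1
  exact (QuotientGroup.eq_one_iff n).1 h2

end CompletedGroupAlgebra

/-- The completed group algebra of a profinite group is a proartinian Hopf algebra, with quotients
the group algebras `k[N / M]`. -/
noncomputable def completedGroupAlgebra (k N : Type*) [Field k] [Group N] [TopologicalSpace N]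
    [IsTopologicalGroup N] [CompactSpace N] : ProartinianHopf k (CompletedGroupAlgebra k N) where
  ι := OpenNormalSubgroup N
  A := fun M => MonoidAlgebra k (N ⧸ M.toSubgroup)
  π := CompletedGroupAlgebra.π
  isTopologicalAddGroup := isTopologicalAddGroup_iInf_induced
    (fun M : OpenNormalSubgroup N => CompletedGroupAlgebra.π (k := k) M)
  surjective := CompletedGroupAlgebra.π_surjective
  isOpen_ker := fun M => isOpen_iInf_induced
    (fun M : OpenNormalSubgroup N => (CompletedGroupAlgebra.π (k := k) M : _ → _)) M 0
  hasBasis := by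
    have : Nonempty (OpenNormalSubgroup N) :=
      ⟨{ toOpenSubgroup := ⊤, isNormal' := inferInstanceAs (⊤ : Subgroup N).Normal }⟩
    have := nhds_iInf_induced
      (fun M : OpenNormalSubgroup N => (CompletedGroupAlgebra.π (k := k) M : _ → _)) 0
      (fun M M' => by
        refine ⟨M ⊓ M', fun y hy => ?_⟩
        rw [map_zero] at hy
        have h1 : (M ⊓ M').toSubgroup ≤ M.toSubgroup := inf_le_left (a := M.toSubgroup)
        have h2 : (M ⊓ M').toSubgroup ≤ M'.toSubgroup := inf_le_right (a := M.toSubgroup)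
        rw [← CompletedGroupAlgebra.map_π h1, ← CompletedGroupAlgebra.map_π h2, hy]
        simp)
    simpa using this
  finite := fun M => by
    have : Finite (N ⧸ M.toSubgroup) :=
      M.toSubgroup.quotient_finite_of_isOpen M.toOpenSubgroup.isOpen
    infer_instance
  transition := fun M M' h =>
    ⟨MonoidAlgebra.mapDomainBialgHom k (QuotientGroup.map M.toSubgroup M'.toSubgroup
      (MonoidHom.id N) (CompletedGroupAlgebra.le_of_ker_le h)),
      fun x => CompletedGroupAlgebra.map_π _ x⟩
  complete := fun x hx => by
    have hx' : ∀ (M M' : OpenNormalSubgroup N) (h : M.toSubgroup ≤ M'.toSubgroup),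
        MonoidAlgebra.mapDomainBialgHom k (QuotientGroup.map M.toSubgroup M'.toSubgroup
          (MonoidHom.id N) h) (x M) = x M' := by
      intro M M' h
      obtain ⟨z, hz⟩ := CompletedGroupAlgebra.π_surjective M (x M)
      rw [← hz, CompletedGroupAlgebra.map_π]
      refine hx M M' (fun y hy => ?_) z hz
      rw [← CompletedGroupAlgebra.map_π h, hy, map_zero]
    exact ⟨⟨x, hx'⟩, fun M => rfl, fun y hy => CompletedGroupAlgebra.ext fun M => hy M⟩

namespace ProartinianHopf

section ModuleAlgebra

variable {K : Type u} {H : Type v} [Field K] [Ring H] [Algebra K H] [TopologicalSpace H]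
  {P : ProartinianHopf K H}

namespace OpenHopfIdeal

section

variable (I : P.OpenHopfIdeal) (L : Type*) [Field L] [Algebra K L] [Module H L]
  [IsScalarTower K H L]

/-- The subspace `L^I` of invariants under an open proartinian Hopf ideal `I`; since the counit
vanishes on `I`, these are the elements annihilated by `I`. -/
def fixed : Submodule K L where
  carrier := {x | ∀ h ∈ I.toSubmodule, h • x = 0}
  add_mem' := fun {x y} hx hy h hh => by rw [smul_add, hx h hh, hy h hh, add_zero]
  zero_mem' := fun h _ => smul_zero h
  smul_mem' := fun k x hx h hh => by
    have : h • k • x = (k • h) • x := by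
      rw [← algebraMap_smul H k x, smul_smul, ← Algebra.commutes, ← Algebra.smul_def]
    rw [this, smul_assoc, hx h hh, smul_zero]

variable {L}

/-- The action of `H / I` on an element of `L^I`. -/
noncomputable def act (x : L) (hx : x ∈ I.fixed L) : I.Quot →ₗ[K] L :=
  ((LinearMap.ker I.proj.toLinearMap).liftQ
    { toFun := fun h : H => h • x
      map_add' := fun h h' => add_smul h h' x
      map_smul' := fun k h => smul_assoc k h x }
    (fun h hh => hx h ((I.proj_eq_zero h).1 hh))) ∘ₗ
    (I.proj.toLinearMap.quotKerEquivOfSurjective I.proj_surjective).symm.toLinearMap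

theorem act_proj (x : L) (hx : x ∈ I.fixed L) (h : H) : I.act x hx (I.proj h) = h • x := by
  have e : (I.proj.toLinearMap.quotKerEquivOfSurjective I.proj_surjective).symm (I.proj h) =
      (LinearMap.ker I.proj.toLinearMap).mkQ h := by
    rw [LinearEquiv.symm_apply_eq]; rfl
  simp only [act, LinearMap.comp_apply, LinearEquiv.coe_coe, e]
  rfl

end

end OpenHopfIdeal

/-- A field extension `L` of `K` with an `H`-module structure is a discrete left `H`-module
algebra: the action is continuous for the discrete topology of `L`, and satisfies
`h • 1 = ε(h) 1` and `h • (x y) = (h₍₁₎ • x) (h₍₂₎ • y)`. In the last condition the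
comultiplication is computed in a quotient `H / I` which acts on `x` and `y`. -/
class IsDiscreteModuleAlgebra (P : ProartinianHopf K H) (L : Type*) [Field L] [Algebra K L]
    [Module H L] [IsScalarTower K H L] : Prop where
  continuous_smul : let _ : TopologicalSpace L := ⊥; Continuous fun p : H × L => p.1 • p.2
  smul_one : ∀ (I : P.OpenHopfIdeal) (h : H),
    h • (1 : L) = algebraMap K L (counit (R := K) (I.proj h))
  smul_mul : ∀ (I : P.OpenHopfIdeal) (x y : L) (hx : x ∈ I.fixed L) (hy : y ∈ I.fixed L) (h : H),
    h • (x * y) = LinearMap.mul' K L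
      (TensorProduct.map (I.act x hx) (I.act y hy) (comul (R := K) (I.proj h)))

section

variable {L : Type*} [Field L] [Algebra K L] [Module H L] [IsScalarTower K H L]

theorem exists_mem_fixed [hL : IsDiscreteModuleAlgebra P L] (x : L) :
    ∃ I : P.OpenHopfIdeal, x ∈ I.fixed L := by
  let _ : TopologicalSpace L := ⊥
  have : DiscreteTopology L := ⟨rfl⟩
  have hc : Continuous fun h : H => h • x :=
    hL.continuous_smul.comp (Continuous.prodMk continuous_id continuous_const)
  obtain ⟨I, hI⟩ := OpenHopfIdeal.exists_le (P := P) {h : H | h • x = 0}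
    (((isOpen_discrete {(0 : L)}).preimage hc).mem_nhds (zero_smul H x))
  exact ⟨I, fun h hh => hI hh⟩

/-- The invariants `L^I` as a subalgebra of `L`. -/
def OpenHopfIdeal.fixedAlgebra (I : P.OpenHopfIdeal) (L : Type*) [Field L] [Algebra K L]
    [Module H L] [IsScalarTower K H L] [hL : IsDiscreteModuleAlgebra P L] : Subalgebra K L where
  carrier := I.fixed L
  add_mem' := (I.fixed L).add_mem
  mul_mem' := fun {x y} hx hy h hh => by
    rw [hL.smul_mul I x y hx hy, (I.proj_eq_zero h).2 hh]
    simp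
  algebraMap_mem' := fun k => by
    rw [Algebra.algebraMap_eq_smul_one]
    refine (I.fixed L).smul_mem k fun h hh => ?_
    rw [hL.smul_one I h, (I.proj_eq_zero h).2 hh]
    simp

theorem OpenHopfIdeal.fixed_mono {I J : P.OpenHopfIdeal} (hIJ : I ≤ J) {x : L}
    (hx : x ∈ J.fixed L) : x ∈ I.fixed L :=
  fun h hh => hx h (hIJ hh)

section HomAction

variable {E : Type*} [Field E] [Algebra K E]

/-- For `f : L → E` and `x` in `L^I`, the map `E ⊗ H / I → E`, `y ⊗ h ↦ y f(h • x)`. -/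
noncomputable def OpenHopfIdeal.evalAct (I : P.OpenHopfIdeal) (f : L →ₗ[K] E) (x : L)
    (hx : x ∈ I.fixed L) : E ⊗[K] I.Quot →ₗ[E] E :=
  (f ∘ₗ I.act x hx).liftBaseChange E

theorem OpenHopfIdeal.evalAct_tmul (I : P.OpenHopfIdeal) (f : L →ₗ[K] E) (x : L)
    (hx : x ∈ I.fixed L) (y : E) (h : H) :
    I.evalAct f x hx (y ⊗ₜ[K] I.proj h) = y * f (h • x) := by
  simp [evalAct, act_proj]

theorem OpenHopfIdeal.evalAct_baseFactor {I J : P.OpenHopfIdeal} (hIJ : I ≤ J) (f : L →ₗ[K] E)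
    (x : L) (hx : x ∈ J.fixed L) (z : E ⊗[K] I.Quot) :
    J.evalAct f x hx (OpenHopfIdeal.baseFactor E hIJ z) =
      I.evalAct f x (OpenHopfIdeal.fixed_mono hIJ hx) z := by
  induction z using TensorProduct.induction_on with
  | zero => simp
  | tmul y b =>
    obtain ⟨h, rfl⟩ := I.proj_surjective b
    simp only [baseFactor, Bialgebra.TensorProduct.map_tmul, factor_proj, evalAct_tmul,
      BialgHom.id_apply]
  | add z w hz hw => rw [map_add, map_add, map_add, hz, hw]

theorem OpenHopfIdeal.evalAct_eq (I J : P.OpenHopfIdeal) (f : L →ₗ[K] E) (x : L)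
    (hI : x ∈ I.fixed L) (hJ : x ∈ J.fixed L) (z : P.CompletedTensor E) :
    I.evalAct f x hI (CompletedTensor.π I z) = J.evalAct f x hJ (CompletedTensor.π J z) := by
  obtain ⟨M, hMI, hMJ⟩ := OpenHopfIdeal.exists_le_le I J
  rw [← CompletedTensor.baseFactor_π hMI, ← CompletedTensor.baseFactor_π hMJ,
    OpenHopfIdeal.evalAct_baseFactor, OpenHopfIdeal.evalAct_baseFactor]

theorem OpenHopfIdeal.act_add (I : P.OpenHopfIdeal) (x y : L) (hx : x ∈ I.fixed L)
    (hy : y ∈ I.fixed L) (hxy : x + y ∈ I.fixed L) : I.act (x + y) hxy = I.act x hx + I.act y hy := by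
  ext b
  obtain ⟨h, rfl⟩ := I.proj_surjective b
  simp [act_proj]

theorem OpenHopfIdeal.act_smul (I : P.OpenHopfIdeal) (k : K) (x : L) (hx : x ∈ I.fixed L)
    (hkx : k • x ∈ I.fixed L) : I.act (k • x) hkx = k • I.act x hx := by
  ext b
  obtain ⟨h, rfl⟩ := I.proj_surjective b
  rw [LinearMap.smul_apply, act_proj, act_proj, ← smul_assoc k h x,
    ← algebraMap_smul H k x, smul_smul, ← Algebra.commutes, ← Algebra.smul_def]

variable [hL : IsDiscreteModuleAlgebra P L]

variable (P) in
/-- The right action of the completed tensor product `E ⊗̂ H` on `Hom_K(L, E)`, given by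
`(f · (y ⊗ h))(x) = y f(h • x)`. On `x` in `L^I` it is computed in `E ⊗ H / I`, for any `I`. -/
noncomputable def homAct (f : L →ₗ[K] E) : P.CompletedTensor E →ₗ[E] (L →ₗ[K] E) where
  toFun := fun z =>
    { toFun := fun x => (exists_mem_fixed (P := P) x).choose.evalAct f x
        (exists_mem_fixed x).choose_spec (CompletedTensor.π _ z)
      map_add' := fun x y => by
        obtain ⟨I, hI⟩ := exists_mem_fixed (P := P) x
        obtain ⟨J, hJ⟩ := exists_mem_fixed (P := P) y
        obtain ⟨M, hMI, hMJ⟩ := OpenHopfIdeal.exists_le_le I J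
        have hx := OpenHopfIdeal.fixed_mono hMI hI
        have hy := OpenHopfIdeal.fixed_mono hMJ hJ
        have hxy := (M.fixed L).add_mem hx hy
        rw [OpenHopfIdeal.evalAct_eq _ M f x _ hx, OpenHopfIdeal.evalAct_eq _ M f y _ hy,
          OpenHopfIdeal.evalAct_eq _ M f (x + y) _ hxy]
        simp only [OpenHopfIdeal.evalAct]
        rw [M.act_add x y hx hy, LinearMap.comp_add, ← LinearMap.add_apply]
        congr 1
        ext
        simp
      map_smul' := fun k x => by
        obtain ⟨M, hx⟩ := exists_mem_fixed (P := P) x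
        have hkx := (M.fixed L).smul_mem k hx
        rw [OpenHopfIdeal.evalAct_eq _ M f x _ hx, OpenHopfIdeal.evalAct_eq _ M f (k • x) _ hkx]
        simp only [OpenHopfIdeal.evalAct]
        rw [M.act_smul k x hx, LinearMap.comp_smul, RingHom.id_apply, ← LinearMap.smul_apply]
        congr 1
        ext
        simp }
  map_add' := fun z w => by
    ext x
    simp only [LinearMap.coe_mk, AddHom.coe_mk, map_add, LinearMap.add_apply]
  map_smul' := fun r z => by
    ext x
    simp only [LinearMap.coe_mk, AddHom.coe_mk, map_smul, LinearMap.smul_apply, RingHom.id_apply]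

theorem homAct_apply (f : L →ₗ[K] E) (z : P.CompletedTensor E) (I : P.OpenHopfIdeal) (x : L)
    (hx : x ∈ I.fixed L) : P.homAct f z x = I.evalAct f x hx (CompletedTensor.π I z) :=
  OpenHopfIdeal.evalAct_eq _ I f x _ hx z

theorem homAct_tmul (f : L →ₗ[K] E) (y : E) (h : H) (x : L) :
    P.homAct f (CompletedTensor.tmul y h) x = y * f (h • x) := by
  obtain ⟨I, hI⟩ := exists_mem_fixed (P := P) x
  rw [homAct_apply f _ I x hI, CompletedTensor.π_tmul, OpenHopfIdeal.evalAct_tmul]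

variable (P L E) in
/-- The canonical map `E ⊗̂ H → Hom_K(L, E)`, `y ⊗ h ↦ (x ↦ y (h • x))`, for a field extension `E`
of `L`. -/
noncomputable def can [Algebra L E] [IsScalarTower K L E] :
    P.CompletedTensor E →ₗ[E] (L →ₗ[K] E) :=
  P.homAct (IsScalarTower.toAlgHom K L E).toLinearMap

variable (P L E) in
/-- The topology of `Hom_K(L, E)` as the projective limit of the discrete spaces
`Hom_K(L^I, E)`. -/
abbrev homTopology : TopologicalSpace (L →ₗ[K] E) :=
  ⨅ I : P.OpenHopfIdeal,
    TopologicalSpace.induced (fun f : L →ₗ[K] E => f.domRestrict (I.fixed L)) ⊥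

end HomAction

/-- The extension `L / K` is `H`-Galois: `L` is a discrete left `H`-module algebra and the
canonical map `L ⊗̂ H → End_K(L)` is a homeomorphism (it is `L`-linear). -/
class IsHopfGalois (P : ProartinianHopf K H) (L : Type*) [Field L] [Algebra K L]
    [Module H L] [IsScalarTower K H L] : Prop extends IsDiscreteModuleAlgebra P L where
  isHomeomorph_can : let _ : TopologicalSpace (L →ₗ[K] L) := P.homTopology L L
    IsHomeomorph (P.can L L)

end
end ModuleAlgebra
end ProartinianHopf

section HomCoalgebra

variable (K A E : Type*) [Field K] [CommRing A] [Algebra K A] [Module.Finite K A] [Field E]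
  [Algebra K E]

/-- The basis `φ` of `Hom_K(A, E)` dual to a basis of `A`. -/
noncomputable def homCoord (i : Fin (Module.finrank K A)) : A →ₗ[K] E :=
  Algebra.linearMap K E ∘ₗ (Module.finBasis K A).coord i

variable {K A E} in
theorem sum_homCoord_mul (f : A →ₗ[K] E) (g : A →ₗ[K] A) (x : A) :
    ∑ i, homCoord K A E i x * f (g (Module.finBasis K A i)) = f (g x) := by
  conv_rhs => rw [← (Module.finBasis K A).sum_repr x]
  simp only [map_sum, map_smul, homCoord, LinearMap.comp_apply, Algebra.linearMap_apply,
    Module.Basis.coord_apply, Algebra.smul_def (A := E)]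

variable {K A E} in
theorem sum_homCoord (f : A →ₗ[K] E) :
    ∑ i, f (Module.finBasis K A i) • homCoord K A E i = f := by
  ext x
  have := sum_homCoord_mul f LinearMap.id x
  simp only [LinearMap.id_apply] at this
  conv_rhs => rw [← this]
  simp [LinearMap.sum_apply, mul_comm]

theorem sum_sum_sum_sum_comm {ι M : Type*} [Fintype ι] [AddCommMonoid M] (F : ι → ι → ι → ι → M) :
    ∑ i, ∑ j, ∑ k, ∑ l, F i j k l = ∑ k, ∑ l, ∑ j, ∑ i, F i j k l := by
  calc ∑ i, ∑ j, ∑ k, ∑ l, F i j k l = ∑ i, ∑ k, ∑ j, ∑ l, F i j k l :=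
        Finset.sum_congr rfl fun i _ => Finset.sum_comm
    _ = ∑ k, ∑ i, ∑ j, ∑ l, F i j k l := Finset.sum_comm
    _ = ∑ k, ∑ i, ∑ l, ∑ j, F i j k l :=
        Finset.sum_congr rfl fun k _ => Finset.sum_congr rfl fun i _ => Finset.sum_comm
    _ = ∑ k, ∑ l, ∑ i, ∑ j, F i j k l := Finset.sum_congr rfl fun k _ => Finset.sum_comm
    _ = ∑ k, ∑ l, ∑ j, ∑ i, F i j k l :=
        Finset.sum_congr rfl fun k _ => Finset.sum_congr rfl fun l _ => Finset.sum_comm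

/-- The comultiplication of `Hom_K(A, E)`. -/
noncomputable def homComul : (A →ₗ[K] E) →ₗ[E] (A →ₗ[K] E) ⊗[E] (A →ₗ[K] E) where
  toFun := fun f => ∑ i, ∑ j, f (Module.finBasis K A i * Module.finBasis K A j) •
    (homCoord K A E i ⊗ₜ[E] homCoord K A E j)
  map_add' := fun f g => by
    simp only [LinearMap.add_apply, add_smul, Finset.sum_add_distrib]
  map_smul' := fun r f => by
    simp only [LinearMap.smul_apply, smul_assoc, Finset.smul_sum, RingHom.id_apply]

variable {K A E} in
theorem homComul_apply (f : A →ₗ[K] E) :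
    homComul K A E f = ∑ i, ∑ j, f (Module.finBasis K A i * Module.finBasis K A j) •
      (homCoord K A E i ⊗ₜ[E] homCoord K A E j) := rfl

/-- The counit of `Hom_K(A, E)`. -/
noncomputable def homCounit : (A →ₗ[K] E) →ₗ[E] E where
  toFun := fun f => f 1
  map_add' := fun _ _ => rfl
  map_smul' := fun _ _ => rfl

variable {K A E} in
/-- The comultiplication of `Hom_K(A, E)` satisfies `f (x y) = f₍₁₎(x) f₍₂₎(y)`. -/
theorem lift_homComul (f : A →ₗ[K] E) (x y : A) :
    LinearMap.mul' E E (TensorProduct.map (LinearMap.applyₗ' E x) (LinearMap.applyₗ' E y)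
      (homComul K A E f)) = f (x * y) := by
  have h1 : ∀ i, ∑ j, homCoord K A E j y *
      f (Module.finBasis K A i * Module.finBasis K A j) = f (Module.finBasis K A i * y) :=
    fun i => sum_homCoord_mul f (LinearMap.mulLeft K (Module.finBasis K A i)) y
  have h2 := sum_homCoord_mul f (LinearMap.mulRight K y) x
  simp only [LinearMap.mulRight_apply] at h2
  rw [← h2, homComul_apply]
  simp only [map_sum, map_smul, TensorProduct.map_tmul, LinearMap.mul'_apply, smul_eq_mul,
    LinearMap.applyₗ'_apply_apply, ← h1, Finset.mul_sum]
  refine Finset.sum_congr rfl fun i _ => Finset.sum_congr rfl fun j _ => ?_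
  ring

/-- The `E`-coalgebra structure on `Hom_K(A, E)` for a finite dimensional `K`-algebra `A`, with
`f (x y) = f₍₁₎(x) f₍₂₎(y)` and `ε(f) = f(1)`. In terms of a basis `e` of `A` with dual basis `φ`,
the comultiplication is `Δ(f) = ∑ f(eᵢ eⱼ) φᵢ ⊗ φⱼ`. -/
noncomputable abbrev homCoalgebra : Coalgebra E (A →ₗ[K] E) where
  comul := homComul K A E
  counit := homCounit K A E
  coassoc := by
    ext f
    have h1 : ∀ k l j, ∑ i, homCoord K A E i (Module.finBasis K A k * Module.finBasis K A l) *
        f (Module.finBasis K A i * Module.finBasis K A j) =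
          f (Module.finBasis K A k * Module.finBasis K A l * Module.finBasis K A j) :=
      fun k l j => sum_homCoord_mul f (LinearMap.mulRight K (Module.finBasis K A j)) _
    have h2 : ∀ k l j, ∑ i, homCoord K A E i (Module.finBasis K A l * Module.finBasis K A j) *
        f (Module.finBasis K A k * Module.finBasis K A i) =
          f (Module.finBasis K A k * (Module.finBasis K A l * Module.finBasis K A j)) :=
      fun k l j => sum_homCoord_mul f (LinearMap.mulLeft K (Module.finBasis K A k)) _
    have e1 : TensorProduct.assoc E _ _ _ ((homComul K A E).rTensor _ (homComul K A E f)) =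
        ∑ k, ∑ l, ∑ j, f (Module.finBasis K A k * Module.finBasis K A l * Module.finBasis K A j) •
          (homCoord K A E k ⊗ₜ[E] (homCoord K A E l ⊗ₜ[E] homCoord K A E j)) := by
      simp only [← h1, Finset.sum_smul]
      rw [homComul_apply]
      simp only [map_sum, map_smul, LinearMap.rTensor_tmul, homComul_apply,
        TensorProduct.sum_tmul, ← TensorProduct.smul_tmul', TensorProduct.assoc_tmul,
        Finset.smul_sum, smul_smul]
      rw [sum_sum_sum_sum_comm]
      simp only [mul_comm]
    have e2 : (homComul K A E).lTensor _ (homComul K A E f) =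
        ∑ k, ∑ l, ∑ j, f (Module.finBasis K A k * (Module.finBasis K A l * Module.finBasis K A j)) •
          (homCoord K A E k ⊗ₜ[E] (homCoord K A E l ⊗ₜ[E] homCoord K A E j)) := by
      simp only [← h2, Finset.sum_smul]
      rw [homComul_apply]
      simp only [map_sum, map_smul, LinearMap.lTensor_tmul, homComul_apply,
        TensorProduct.tmul_sum, TensorProduct.tmul_smul, Finset.smul_sum, smul_smul]
      refine Finset.sum_congr rfl fun k _ => ?_
      rw [Finset.sum_comm]
      rw [Finset.sum_congr rfl fun l _ => Finset.sum_comm]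
      simp only [mul_comm]
    simp only [LinearMap.comp_apply, LinearEquiv.coe_coe]
    rw [e1, e2]
    simp only [mul_assoc]
  rTensor_counit_comp_comul := by
    ext f
    have h : ∀ j, ∑ i, homCoord K A E i 1 * f (Module.finBasis K A i * Module.finBasis K A j) =
        f (Module.finBasis K A j) := fun j => by
      simpa using sum_homCoord_mul f (LinearMap.mulRight K (Module.finBasis K A j)) 1
    simp only [LinearMap.comp_apply, TensorProduct.mk_apply]
    conv_rhs => rw [← sum_homCoord f]
    rw [homComul_apply]
    simp only [← h, map_sum, map_smul, LinearMap.rTensor_tmul, homCounit, LinearMap.coe_mk,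
      AddHom.coe_mk, TensorProduct.tmul_sum, Finset.sum_smul, TensorProduct.tmul_smul,
      TensorProduct.smul_tmul', smul_eq_mul, mul_one]
    rw [Finset.sum_comm]
    simp only [mul_comm]
  lTensor_counit_comp_comul := by
    ext f
    have h : ∀ i, ∑ j, homCoord K A E j 1 * f (Module.finBasis K A i * Module.finBasis K A j) =
        f (Module.finBasis K A i) := fun i => by
      simpa using sum_homCoord_mul f (LinearMap.mulLeft K (Module.finBasis K A i)) 1
    simp only [LinearMap.comp_apply, LinearMap.flip_apply, TensorProduct.mk_apply]
    conv_rhs => rw [← sum_homCoord f]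
    rw [homComul_apply]
    simp only [← h, map_sum, map_smul, LinearMap.lTensor_tmul, homCounit, LinearMap.coe_mk,
      AddHom.coe_mk, TensorProduct.sum_tmul, Finset.sum_smul, ← TensorProduct.tmul_smul,
      TensorProduct.smul_tmul, smul_eq_mul, mul_one]
    simp only [mul_comm]

end HomCoalgebra
end HopfGalois

/-! Let $\sigma : L \to E$ be an embedding over $K$. At level $I$ the map $E \otimes H/I \to
\mathrm{Hom}_K(L^I, E)$, $y \otimes h \mapsto (x \mapsto y\,\sigma(h x))$ (`levelEval`), respects
the coalgebra structures: this is the module algebra axiom (`evalAct_one`, `evalAct_mul`). Grouplike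
elements on the right are algebra morphisms $L^I \to E$. If these level maps were isomorphisms,
$N_I$ would simply be the set of embeddings of $L^I$.

In general a single level need not give an isomorphism; the homeomorphism $\mathrm{can}_L$ gives an
isomorphism of projective systems. Surjectivity of $\mathrm{can}_L$ makes each level map surjective,
which forces $L^I$ to be finite-dimensional. Openness together with injectivity yields, for each
$I$, some $J \le I$ such that the kernel at level $J$ dies in $E \otimes H/I$
(`exists_le_forall_levelEval`). Hence there is a linear map $s : \mathrm{Hom}_K(L^J, E) \to E
\otimes H/I$ whose composite with the level map at $J$ is the transition map
(`exists_levelInverse`). Both facts are first obtained over $L$ and then carried to $E$ by base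
change along $\sigma$.

Consequently $z \mapsto \sigma \cdot z$ is bijective from $E \hat\otimes H$ to $\mathrm{Hom}_K(L,
E)$, and $\sigma \cdot z$ is an algebra morphism exactly when every component of $z$ is grouplike
(`exists_homAct_toCompletedTensor`, `isGroupLikeElem_of_homAct_eq`). So $N$ acts simply transitively
from the right on the embeddings $L \to E$ (`algHomAct_bijective`).

Now take $E = \tilde L$. By Dedekind's lemma and a count, the embeddings of $L^J$ form a basis of
$\mathrm{Hom}_K(L^J, \tilde L)$, and by normality each extends to $L$, so it comes from an element
of $N$. Applying $s$ shows that the components of elements of $N$ span $\tilde L \otimes H/I$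
(`span_range_π`). Grouplike elements are linearly independent, so $\tilde L \otimes H/I$ is the
group algebra of $N_I$ and $N \to N_I$ is onto. Passing to the limit along the cofinal kernels of $N
\to N_I$ gives the completed group algebra. Finally $G/G'$ is the set of embeddings of $L$ in
$\tilde L$, so the simply transitive action based at the inclusion gives $\beta$; its continuity
rests on the finiteness of the $L^J$ and the compactness of $G$. -/

namespace HopfGalois
namespace ProartinianHopf

/-! ### Evaluation maps at a finite level -/

section LevelEval

variable {K H L E : Type*} [Field K] [Ring H] [Algebra K H] [TopologicalSpace H]
  {P : ProartinianHopf K H} [Field L] [Algebra K L] [Module H L] [IsScalarTower K H L]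
  [Field E] [Algebra K E]

theorem OpenHopfIdeal.smul_mem_fixed (I : P.OpenHopfIdeal) {x : L} (hx : x ∈ I.fixed L) (h : H) :
    h • x ∈ I.fixed L := fun h' hh' => by
  rw [smul_smul]
  exact hx _ (I.toIdeal.mul_mem_right h hh')

theorem OpenHopfIdeal.evalAct_mul_tmul (I : P.OpenHopfIdeal) (f : L →ₗ[K] E) {x : L}
    (hx : x ∈ I.fixed L) (z : E ⊗[K] I.Quot) (y : E) (h : H) :
    I.evalAct f x hx (z * y ⊗ₜ I.proj h) =
      y * I.evalAct f (h • x) (I.smul_mem_fixed hx h) z := by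
  induction z using TensorProduct.induction_on with
  | zero => simp
  | tmul y' b =>
    obtain ⟨h', rfl⟩ := I.proj_surjective b
    rw [Algebra.TensorProduct.tmul_mul_tmul, ← map_mul, evalAct_tmul, evalAct_tmul, smul_smul]
    ring
  | add z w hz hw => rw [add_mul, map_add, map_add, hz, hw, mul_add]

variable [hL : IsDiscreteModuleAlgebra P L]

/-- Both sides at $x \in L^I$ depend only on the components at $I$. There the identity reduces to
$(h'h)x = h'(hx)$, because $hx$ stays in $L^I$. -/
theorem homAct_mul (f : L →ₗ[K] E) (z w : P.CompletedTensor E) :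
    P.homAct f (z * w) = P.homAct (P.homAct f z) w := by
  ext x
  obtain ⟨I, hx⟩ := exists_mem_fixed (P := P) x
  rw [homAct_apply _ _ I x hx, homAct_apply _ _ I x hx, map_mul]
  generalize CompletedTensor.π I w = t
  induction t using TensorProduct.induction_on with
  | zero => simp
  | tmul y b =>
    obtain ⟨h, rfl⟩ := I.proj_surjective b
    rw [OpenHopfIdeal.evalAct_mul_tmul, OpenHopfIdeal.evalAct_tmul,
      homAct_apply _ _ I _ (I.smul_mem_fixed hx h)]
  | add s t hs ht => rw [mul_add, map_add, map_add, hs, ht]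

theorem homAct_one (f : L →ₗ[K] E) : P.homAct f 1 = f := by
  ext x
  have := homAct_tmul (P := P) f 1 1 x
  rwa [one_smul, one_mul] at this

namespace OpenHopfIdeal

variable (I : P.OpenHopfIdeal)

/-- The map `E ⊗ H / I → Hom_K(L^I, E)`, `y ⊗ h ↦ (x ↦ y f(h • x))`, for `f : L → E`. -/
noncomputable def levelEval (f : L →ₗ[K] E) :
    E ⊗[K] I.Quot →ₗ[E] (I.fixedAlgebra L →ₗ[K] E) where
  toFun z :=
    { toFun := fun x => I.evalAct f x.1 x.2 z
      map_add' := fun x y => by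
        have h : I.evalAct f (x.1 + y.1) (x + y).2 = I.evalAct f x.1 x.2 + I.evalAct f y.1 y.2 := by
          simp only [evalAct]
          rw [I.act_add x.1 y.1 x.2 y.2 (x + y).2]
          ext
          simp
        exact LinearMap.congr_fun h z
      map_smul' := fun k x => by
        have h : I.evalAct f (k • x.1) (k • x).2 = k • I.evalAct f x.1 x.2 := by
          simp only [evalAct]
          rw [I.act_smul k x.1 x.2 (k • x).2]
          ext
          simp
        exact LinearMap.congr_fun h z }
  map_add' z w := by
    ext x
    exact map_add (I.evalAct f x.1 x.2) z w
  map_smul' r z := by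
    ext x
    exact map_smul (I.evalAct f x.1 x.2) r z

variable {I}

theorem levelEval_tmul (f : L →ₗ[K] E) (y : E) (h : H) (x : I.fixedAlgebra L) :
    I.levelEval f (y ⊗ₜ I.proj h) x = y * f (h • x.1) :=
  I.evalAct_tmul f x.1 x.2 y h

theorem levelEval_π (f : L →ₗ[K] E) (z : P.CompletedTensor E) (x : I.fixedAlgebra L) :
    I.levelEval f (CompletedTensor.π I z) x = P.homAct f z x.1 :=
  (homAct_apply f z I x.1 x.2).symm

theorem levelEval_baseFactor {J : P.OpenHopfIdeal} (hIJ : I ≤ J) (f : L →ₗ[K] E)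
    (z : E ⊗[K] I.Quot) (x : J.fixedAlgebra L) :
    J.levelEval f (baseFactor E hIJ z) x = I.levelEval f z ⟨x.1, fixed_mono hIJ x.2⟩ :=
  evalAct_baseFactor hIJ f x.1 x.2 z

/-- With `evalAct_mul`, this says that `levelEval` at an algebra morphism is compatible with counit
and comultiplication. It is formulated by evaluation at elements, so that it is available before
$L^I$ is known to be finite-dimensional and $\mathrm{Hom}_K(L^I, E)$ is a coalgebra. -/
theorem evalAct_one (σ : L →ₐ[K] E) (h1 : (1 : L) ∈ I.fixed L) (z : E ⊗[K] I.Quot) :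
    I.evalAct σ.toLinearMap 1 h1 z = counit (R := E) z := by
  induction z using TensorProduct.induction_on with
  | zero => simp
  | tmul y b =>
    obtain ⟨h, rfl⟩ := I.proj_surjective b
    rw [evalAct_tmul, hL.smul_one I h]
    simp [Algebra.smul_def, mul_comm]
  | add z w hz hw => rw [map_add, map_add, hz, hw]

theorem evalAct_mul (σ : L →ₐ[K] E) {x y : L} (hx : x ∈ I.fixed L) (hy : y ∈ I.fixed L)
    (hxy : x * y ∈ I.fixed L) (z : E ⊗[K] I.Quot) :
    I.evalAct σ.toLinearMap (x * y) hxy z =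
      LinearMap.mul' E E (TensorProduct.map (I.evalAct σ.toLinearMap x hx)
        (I.evalAct σ.toLinearMap y hy) (comul (R := E) z)) := by
  induction z using TensorProduct.induction_on with
  | zero => simp
  | tmul e b =>
    obtain ⟨h, rfl⟩ := I.proj_surjective b
    rw [evalAct_tmul, AlgHom.toLinearMap_apply, hL.smul_mul I x y hx hy h,
      TensorProduct.comul_tmul]
    generalize comul (R := K) (I.proj h) = t
    induction t using TensorProduct.induction_on with
    | zero => simp
    | tmul b c =>
      simp [evalAct, LinearMap.liftBaseChange_tmul]
      ring
    | add s t hs ht =>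
      simp only [TensorProduct.tmul_add, map_add, mul_add, hs, ht]
  | add z w hz hw => simp only [map_add, hz, hw]

end OpenHopfIdeal

end LevelEval
end ProartinianHopf
end HopfGalois

/-! ### Separating elements of tensor products -/

namespace HopfGalois

/-- Expand $v$ along a $K$-basis of $B$: its coordinates lie in the $L$-vector space $E$, where
linear functionals separate points. This reduces injectivity statements over $E$ to statements over
$L$. -/
theorem rTensor_eq_zero_of_forall_dual {K L E B : Type*} [Field K] [Field L] [Field E]
    [Algebra K L] [Algebra K E] [Algebra L E] [IsScalarTower K L E] [AddCommGroup B] [Module K B]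
    (v : E ⊗[K] B) (hv : ∀ l : E →ₗ[L] L, (l.restrictScalars K).rTensor B v = 0) : v = 0 := by
  classical
  let b := Module.Basis.ofVectorSpace K B
  refine (TensorProduct.equivFinsuppOfBasisRight b).injective ?_
  rw [map_zero]
  ext j
  refine (Module.forall_dual_apply_eq_zero_iff L _).1 fun l => ?_
  have key : ∀ w : E ⊗[K] B, l (TensorProduct.equivFinsuppOfBasisRight b w j) =
      TensorProduct.equivFinsuppOfBasisRight b ((l.restrictScalars K).rTensor B w) j := by
    intro w
    induction w using TensorProduct.induction_on with
    | zero => simp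
    | tmul y c => simp
    | add s t hs ht => simp only [map_add, Finsupp.add_apply, hs, ht]
  rw [key, hv, map_zero, Finsupp.zero_apply]

/-- Elements of `Hom_K(A, E) ⊗ Hom_K(A, E)` are determined by their values on `A × A`. -/
theorem eq_zero_of_forall_eval {K A E : Type*} [Field K] [CommRing A] [Algebra K A]
    [Module.Finite K A] [Field E] [Algebra K E] (t : (A →ₗ[K] E) ⊗[E] (A →ₗ[K] E))
    (ht : ∀ x y : A, LinearMap.mul' E E (TensorProduct.map (LinearMap.applyₗ' E x)
      (LinearMap.applyₗ' E y) t) = 0) : t = 0 := by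
  have key : ∀ t : (A →ₗ[K] E) ⊗[E] (A →ₗ[K] E), t = ∑ i, ∑ j,
      LinearMap.mul' E E (TensorProduct.map (LinearMap.applyₗ' E (Module.finBasis K A i))
        (LinearMap.applyₗ' E (Module.finBasis K A j)) t) •
        (homCoord K A E i ⊗ₜ[E] homCoord K A E j) := by
    intro t
    induction t using TensorProduct.induction_on with
    | zero => simp
    | tmul f g =>
      conv_lhs => rw [← sum_homCoord f, ← sum_homCoord g]
      simp only [TensorProduct.sum_tmul, TensorProduct.tmul_sum, TensorProduct.tmul_smul,
        ← TensorProduct.smul_tmul', TensorProduct.map_tmul, LinearMap.mul'_apply,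
        LinearMap.applyₗ'_apply_apply]
      simp only [Finset.smul_sum, smul_smul]
      rw [Finset.sum_comm]
      simp only [mul_comm]
    | add s t hs ht =>
      conv_lhs => rw [hs, ht]
      simp only [map_add, add_smul, Finset.sum_add_distrib]
  rw [key t]
  simp [ht]

namespace ProartinianHopf

/-! ### The Galois condition as an isomorphism of projective systems -/

section Galois

variable {K H L E : Type*} [Field K] [Ring H] [Algebra K H] [TopologicalSpace H]
  {P : ProartinianHopf K H} [Field L] [Algebra K L] [Module H L] [IsScalarTower K H L]
  [Field E] [Algebra K E]

/-- The element of the completed tensor product given by a compatible family. -/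
noncomputable def CompletedTensor.mk (x : ∀ I : P.OpenHopfIdeal, E ⊗[K] I.Quot)
    (hx : ∀ I J (hIJ : I ≤ J), OpenHopfIdeal.baseFactor E hIJ (x I) = x J) :
    P.CompletedTensor E :=
  ⟨x, hx⟩

theorem CompletedTensor.π_mk (x : ∀ I : P.OpenHopfIdeal, E ⊗[K] I.Quot)
    (hx : ∀ I J (hIJ : I ≤ J), OpenHopfIdeal.baseFactor E hIJ (x I) = x J)
    (I : P.OpenHopfIdeal) : CompletedTensor.π I (CompletedTensor.mk x hx) = x I := rfl

namespace OpenHopfIdeal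

section

variable [hL : IsDiscreteModuleAlgebra P L] {I J : P.OpenHopfIdeal}

theorem exists_extend (f : I.fixedAlgebra L →ₗ[K] E) :
    ∃ g : L →ₗ[K] E, ∀ x : I.fixedAlgebra L, g x = f x := by
  obtain ⟨g, hg⟩ := LinearMap.exists_extend (p := (I.fixedAlgebra L).toSubmodule) f
  exact ⟨g, fun x => LinearMap.congr_fun hg x⟩

variable (I) in
/-- The map `E ⊗ H / I → F ⊗ H / I` induced by a morphism `E → F`. -/
noncomputable abbrev mapCoeff {F : Type*} [Field F] [Algebra K F] (τ : E →ₐ[K] F) :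
    E ⊗[K] I.Quot →ₐ[K] F ⊗[K] I.Quot :=
  Algebra.TensorProduct.map τ (AlgHom.id K I.Quot)

theorem levelEval_mapCoeff {F : Type*} [Field F] [Algebra K F] (τ : E →ₐ[K] F) (f : L →ₗ[K] E)
    (z : E ⊗[K] I.Quot) (x : I.fixedAlgebra L) :
    I.levelEval (τ.toLinearMap ∘ₗ f) (I.mapCoeff τ z) x = τ (I.levelEval f z x) := by
  induction z using TensorProduct.induction_on with
  | zero => simp
  | tmul y b =>
    obtain ⟨h, rfl⟩ := I.proj_surjective b
    rw [Algebra.TensorProduct.map_tmul, AlgHom.id_apply, levelEval_tmul, levelEval_tmul, map_mul]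
    rfl
  | add z w hz hw => simp only [map_add, LinearMap.add_apply, hz, hw]

theorem baseFactor_mapCoeff {F : Type*} [Field F] [Algebra K F] (τ : E →ₐ[K] F) (hIJ : I ≤ J)
    (z : E ⊗[K] I.Quot) :
    baseFactor F hIJ (I.mapCoeff τ z) = J.mapCoeff τ (baseFactor E hIJ z) := by
  induction z using TensorProduct.induction_on with
  | zero => simp
  | tmul y b => simp [baseFactor]
  | add z w hz hw => simp only [map_add, hz, hw]

theorem baseFactor_rTensor {F : Type*} [Field F] [Algebra K F] (l : E →ₗ[K] F) (hIJ : I ≤ J)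
    (z : E ⊗[K] I.Quot) :
    baseFactor F hIJ (l.rTensor I.Quot z) = l.rTensor J.Quot (baseFactor E hIJ z) := by
  induction z using TensorProduct.induction_on with
  | zero => simp
  | tmul y b => simp [baseFactor]
  | add z w hz hw => simp only [map_add, hz, hw]

theorem baseFactor_surjective (hIJ : I ≤ J) : Function.Surjective (baseFactor E hIJ) := by
  intro z
  obtain ⟨w, rfl⟩ := CompletedTensor.π_surjective J z
  exact ⟨CompletedTensor.π I w, CompletedTensor.baseFactor_π hIJ w⟩

theorem baseFactor_comp {M : P.OpenHopfIdeal} (hIJ : I ≤ J) (hJM : J ≤ M) (hIM : I ≤ M)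
    (z : E ⊗[K] I.Quot) :
    baseFactor E hJM (baseFactor E hIJ z) = baseFactor E hIM z := by
  obtain ⟨w, rfl⟩ := CompletedTensor.π_surjective I z
  simp only [CompletedTensor.baseFactor_π]

end

variable [hG : P.IsHopfGalois L] {I J : P.OpenHopfIdeal}

theorem can_self : P.can L L = P.homAct LinearMap.id := rfl

/-- A linear map on $L^I$ extends to $L$, and the extension is in the image of $\mathrm{can}_L$. -/
theorem levelEval_id_surjective :
    Function.Surjective (I.levelEval (LinearMap.id : L →ₗ[K] L)) := by
  intro f
  obtain ⟨g, hg⟩ := exists_extend f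
  let _ : TopologicalSpace (L →ₗ[K] L) := P.homTopology L L
  obtain ⟨z, hz⟩ := hG.isHomeomorph_can.surjective g
  refine ⟨CompletedTensor.π I z, LinearMap.ext fun x => ?_⟩
  rw [levelEval_π, ← hg, ← hz, can_self]

/-- The basis may be infinite: this is what bounds the dimension of $L^I$ before it is known to be
finite. -/
theorem linearIndependent_coord {ι A : Type*} [AddCommGroup A] [Module K A]
    (b : Module.Basis ι K A) :
    LinearIndependent E (fun i => Algebra.linearMap K E ∘ₗ b.coord i : ι → (A →ₗ[K] E)) := by
  classical
  rw [linearIndependent_iff']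
  intro s c hc i hi
  have := LinearMap.congr_fun hc (b i)
  simpa [LinearMap.sum_apply, Finsupp.single_apply, hi] using this

-- The quotient $H/I$ is finite-dimensional, so $\mathrm{Hom}_K(L^I, L)$, being a quotient of $L
-- \otimes H/I$, is finite-dimensional over $L$. It contains as many independent elements as a
-- $K$-basis of $L^I$ has.
variable (I L) in
theorem finite_fixedAlgebra : Module.Finite K (I.fixedAlgebra L) := by
  have := I.finite_quot
  have hfin : Module.Finite L (I.fixedAlgebra L →ₗ[K] L) :=
    Module.Finite.of_surjective _ (levelEval_id_surjective (I := I))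
  let b := Module.Basis.ofVectorSpace K (I.fixedAlgebra L)
  have := (linearIndependent_coord (E := L) b).finite
  exact Module.Finite.of_basis b

/-- The space $\mathrm{Hom}_K(L^I, E)$ is spanned over $E$ by the $K$-valued coordinate functionals.
These are hit already over $L$, and $\sigma$ transports their preimages. -/
theorem levelEval_surjective (σ : L →ₐ[K] E) :
    Function.Surjective (I.levelEval σ.toLinearMap) := by
  have := I.finite_fixedAlgebra L
  rw [← LinearMap.range_eq_top, eq_top_iff]
  rintro f -
  rw [← sum_homCoord f]
  refine Submodule.sum_mem _ fun i _ => Submodule.smul_mem _ _ ?_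
  obtain ⟨w, hw⟩ := levelEval_id_surjective (I := I) (homCoord K (I.fixedAlgebra L) L i)
  refine ⟨I.mapCoeff σ w, LinearMap.ext fun x => ?_⟩
  have h := levelEval_mapCoeff σ LinearMap.id w x
  rw [LinearMap.comp_id] at h
  rw [h, hw]
  simp [homCoord]

-- This is the only use of the openness of $\mathrm{can}_L$. It replaces injectivity at one level by
-- the vanishing of the kernel after passing to a coarser quotient.
variable (I L) in
theorem exists_le_forall_levelEval_id : ∃ (J : P.OpenHopfIdeal) (hJI : J ≤ I),
    ∀ w : L ⊗[K] J.Quot, J.levelEval (LinearMap.id : L →ₗ[K] L) w = 0 →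
      baseFactor L hJI w = 0 := by
  let _ : TopologicalSpace (L →ₗ[K] L) := P.homTopology L L
  have ho := hG.isHomeomorph_can.isOpenMap _
    (isOpen_iInf_induced (fun I : P.OpenHopfIdeal => (CompletedTensor.π (E := L) I : _ → _)) I 0)
  have hb := nhds_iInf_induced
    (fun (I : P.OpenHopfIdeal) (f : L →ₗ[K] L) => f.domRestrict (I.fixed L)) 0 (fun I J => by
      obtain ⟨M, hI, hJ⟩ := OpenHopfIdeal.exists_le_le I J
      refine ⟨M, fun f hf => ⟨LinearMap.ext fun x => ?_, LinearMap.ext fun x => ?_⟩⟩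
      · exact LinearMap.congr_fun hf ⟨x.1, fixed_mono hI x.2⟩
      · exact LinearMap.congr_fun hf ⟨x.1, fixed_mono hJ x.2⟩)
  -- The image under $\mathrm{can}_L$ of the kernel of $\pi_I$ is an open neighbourhood of $0$, so
  -- it contains all maps vanishing on some $L^{J_0}$.
  obtain ⟨J₀, -, hJ₀⟩ := hb.mem_iff.1 (ho.mem_nhds ⟨0, map_zero _, map_zero _⟩)
  obtain ⟨J, hJJ₀, hJI⟩ := OpenHopfIdeal.exists_le_le J₀ I
  refine ⟨J, hJI, fun w hw => ?_⟩
  obtain ⟨z, rfl⟩ := CompletedTensor.π_surjective J w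
  -- Since $L^{J_0} \subseteq L^J$, $\mathrm{can}_L(z)$ vanishes on $L^{J_0}$ and equals
  -- $\mathrm{can}_L(u)$ with $\pi_I(u) = 0$. Injectivity then gives $z = u$.
  obtain ⟨u, hu, huz⟩ := hJ₀ (show P.can L L z ∈ _ from LinearMap.ext fun x => by
    have := LinearMap.congr_fun hw ⟨x.1, fixed_mono hJJ₀ x.2⟩
    rw [levelEval_π] at this
    exact this)
  rw [CompletedTensor.baseFactor_π, ← hG.isHomeomorph_can.injective huz]
  exact hu

-- The level $J$ found over $L$ works over every $E$. View $E$ as an $L$-space through $\sigma$: an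
-- $L$-linear functional $E \to L$ turns evaluation at $\sigma$ into evaluation at the identity, and
-- such functionals detect zero in $E \otimes H/I$.
variable (I) in
theorem exists_le_forall_levelEval (σ : L →ₐ[K] E) : ∃ (J : P.OpenHopfIdeal) (hJI : J ≤ I),
    ∀ w : E ⊗[K] J.Quot, J.levelEval σ.toLinearMap w = 0 → baseFactor E hJI w = 0 := by
  obtain ⟨J, hJI, hJ⟩ := I.exists_le_forall_levelEval_id L
  refine ⟨J, hJI, fun w hw => ?_⟩
  let _ : Algebra L E := σ.toRingHom.toAlgebra
  have : IsScalarTower K L E := IsScalarTower.of_algebraMap_eq fun k => (σ.commutes k).symm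
  refine rTensor_eq_zero_of_forall_dual (L := L) _ fun l => ?_
  rw [← baseFactor_rTensor]
  refine hJ _ (LinearMap.ext fun x => ?_)
  have key : ∀ w : E ⊗[K] J.Quot, J.levelEval LinearMap.id
      ((l.restrictScalars K).rTensor J.Quot w) x = l (J.levelEval σ.toLinearMap w x) := by
    intro w
    induction w using TensorProduct.induction_on with
    | zero => simp
    | tmul y b =>
      obtain ⟨h, rfl⟩ := J.proj_surjective b
      have : y * σ.toLinearMap (h • x.1) = (h • x.1) • y := mul_comm _ _
      rw [LinearMap.rTensor_tmul, levelEval_tmul, levelEval_tmul, this, l.map_smul]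
      exact mul_comm _ _
    | add z w hz hw => simp only [map_add, LinearMap.add_apply, hz, hw]
  rw [key, hw]
  simp

variable (I) in
/-- The pro-inverse of the maps `E ⊗ H / I → Hom_K(L^I, E)`. -/
theorem exists_levelInverse (σ : L →ₐ[K] E) : ∃ (J : P.OpenHopfIdeal) (hJI : J ≤ I)
    (s : (J.fixedAlgebra L →ₗ[K] E) →ₗ[E] E ⊗[K] I.Quot),
      ∀ w : E ⊗[K] J.Quot, s (J.levelEval σ.toLinearMap w) = baseFactor E hJI w := by
  obtain ⟨J, hJI, hJ⟩ := I.exists_le_forall_levelEval σ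
  let q := (J.levelEval σ.toLinearMap).quotKerEquivOfSurjective (levelEval_surjective σ)
  refine ⟨J, hJI, (LinearMap.ker (J.levelEval σ.toLinearMap)).liftQ
    (baseFactor E hJI).toCoalgHom.toLinearMap hJ ∘ₗ q.symm.toLinearMap, fun w => ?_⟩
  have e : q.symm (J.levelEval σ.toLinearMap w) = Submodule.mkQ _ w := by
    rw [LinearEquiv.symm_apply_eq]; rfl
  rw [LinearMap.comp_apply, LinearEquiv.coe_coe, e]
  rfl

end OpenHopfIdeal

variable [hG : P.IsHopfGalois L]

open OpenHopfIdeal in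
theorem homAct_injective (σ : L →ₐ[K] E) : Function.Injective (P.homAct σ.toLinearMap) := by
  rw [← LinearMap.ker_eq_bot, LinearMap.ker_eq_bot']
  intro z hz
  refine CompletedTensor.ext fun I => ?_
  obtain ⟨J, hJI, hJ⟩ := I.exists_le_forall_levelEval σ
  rw [← CompletedTensor.baseFactor_π hJI, map_zero]
  refine hJ _ (LinearMap.ext fun x => ?_)
  rw [levelEval_π, hz]
  rfl

-- Preimages $w_I$ of $f|_{L^I}$ exist at each level but need not be compatible. Two choices at
-- level $J(I)$ agree after projection to $I$, so the images of $w_{J(I)}$ in $E \otimes H/I$ form a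
-- compatible family.
open OpenHopfIdeal in
theorem homAct_surjective (σ : L →ₐ[K] E) : Function.Surjective (P.homAct σ.toLinearMap) := by
  intro f
  have h1 : ∀ I : P.OpenHopfIdeal, ∃ w : E ⊗[K] I.Quot,
      ∀ x, I.levelEval σ.toLinearMap w x = f x.1 := fun I => by
    obtain ⟨w, hw⟩ := levelEval_surjective (I := I) σ (f ∘ₗ (I.fixedAlgebra L).val.toLinearMap)
    exact ⟨w, fun x => LinearMap.congr_fun hw x⟩
  choose w hw using h1
  choose J hJI hJ using fun I : P.OpenHopfIdeal => I.exists_le_forall_levelEval σ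
  -- The component at $I$ can be computed from any $M \le J(I)$. Compatibility then follows by
  -- comparing two components at a common refinement.
  have key : ∀ (I M : P.OpenHopfIdeal) (hMJ : M ≤ J I) (hMI : M ≤ I),
      baseFactor E (hJI I) (w (J I)) = baseFactor E hMI (w M) := by
    intro I M hMJ hMI
    rw [← baseFactor_comp hMJ (hJI I) hMI, ← sub_eq_zero, ← map_sub]
    refine hJ I _ (LinearMap.ext fun x => ?_)
    rw [map_sub, LinearMap.sub_apply, levelEval_baseFactor, hw, hw, sub_self]
    rfl
  refine ⟨CompletedTensor.mk (fun I => baseFactor E (hJI I) (w (J I))) fun I I' hII' => ?_,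
    LinearMap.ext fun x => ?_⟩
  · obtain ⟨M, hM, hM'⟩ := OpenHopfIdeal.exists_le_le (J I) (J I')
    have hMI := le_trans' hM (hJI I)
    rw [key I M hM hMI, key I' M hM' (le_trans' hM' (hJI I')), baseFactor_comp]
  · obtain ⟨I, hx⟩ := exists_mem_fixed (P := P) x
    have h := levelEval_baseFactor (hJI I) σ.toLinearMap (w (J I)) ⟨x, hx⟩
    rw [hw] at h
    rw [homAct_apply _ _ I x hx, CompletedTensor.π_mk]
    exact h

end Galois
end ProartinianHopf
end HopfGalois

/-! ### Embeddings as bases and as grouplike elements -/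

namespace HopfGalois

/-- The map $\iota(a) \mapsto \varphi(a)$ is an isomorphism between subfields of the normal
extension $F$, and lifts to an automorphism. The algebra $A$ is only a ring satisfying `IsField`, so
that the subalgebras $L^I$ can be used without a second ring structure. -/
theorem exists_algEquiv_extend {K A F : Type*} [Field K] [Field F] [Algebra K F] [Normal K F]
    [CommRing A] [Algebra K A] (hA : IsField A) (ι φ : A →ₐ[K] F) :
    ∃ g : Gal(F/K), ∀ a, φ a = g (ι a) := by
  let _ : Field A := hA.toField
  let _ : Algebra A F := ι.toRingHom.toAlgebra
  have : IsScalarTower K A F := IsScalarTower.of_algebraMap_eq fun k => (ι.commutes k).symm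
  let r : A →ₐ[K] φ.fieldRange := AlgHom.codRestrict φ φ.fieldRange.toSubalgebra fun a => ⟨a, rfl⟩
  exact ⟨AlgEquiv.ofBijective (r.liftNormal F) (AlgHom.normal_bijective K F F _),
    fun a => (r.liftNormal_commutes F a).symm⟩

/-- Dedekind's lemma gives independence. Separability and splitting give $[A:K]$ embeddings, which
is the dimension of $\mathrm{Hom}_K(A, F)$. -/
theorem exists_basis_algHom {K A F : Type*} [Field K] [Field F] [Algebra K F]
    [CommRing A] [Algebra K A] [Module.Finite K A] (hA : IsField A)
    (hsep : ∀ a : A, IsSeparable K a)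
    (hs : ∀ a : A, ((minpoly K a).map (algebraMap K F)).Splits) :
    ∃ b : Module.Basis (A →ₐ[K] F) F (A →ₗ[K] F), ∀ φ, b φ = φ.toLinearMap := by
  let _ : Field A := hA.toField
  have : Algebra.IsSeparable K A := ⟨hsep⟩
  have hl := linearIndependent_algHom_toLinearMap K A F
  have := hl.finite
  have := Fintype.ofFinite (A →ₐ[K] F)
  have := FiniteDimensional.of_finrank_pos (K := K) (V := A) Module.finrank_pos
  have hc : Fintype.card (A →ₐ[K] F) = Module.finrank F (A →ₗ[K] F) := by
    rw [Module.finrank_linearMap_self, Fintype.card_eq_nat_card]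
    exact AlgHom.natCard_of_splits K A F hs
  have : Nonempty (A →ₐ[K] F) := by
    rw [← Fintype.card_pos_iff, hc, Module.finrank_linearMap_self]
    exact Module.finrank_pos
  exact ⟨basisOfLinearIndependentOfCardEqFinrank hl hc, fun φ => by simp⟩

/-- The grouplike elements of `Hom_K(A, E)` are the algebra morphisms. -/
theorem isGroupLikeElem_hom_iff {K A E : Type*} [Field K] [CommRing A] [Algebra K A]
    [Module.Finite K A] [Field E] [Algebra K E] (f : A →ₗ[K] E) :
    (letI := homCoalgebra K A E
     IsGroupLikeElem E f) ↔ ∃ φ : A →ₐ[K] E, f = φ.toLinearMap := by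
  let _ := homCoalgebra K A E
  have h1 : counit (R := E) f = f 1 := rfl
  have h2 : ∀ x y, LinearMap.mul' E E (TensorProduct.map (LinearMap.applyₗ' E x)
      (LinearMap.applyₗ' E y) (comul (R := E) f)) = f (x * y) := lift_homComul f
  constructor
  · intro h
    refine ⟨AlgHom.ofLinearMap f (h1 ▸ h.counit_eq_one) fun x y => ?_, rfl⟩
    rw [← h2, h.comul_eq_tmul_self]
    rfl
  · rintro ⟨φ, rfl⟩
    refine ⟨h1.trans (map_one φ), ?_⟩
    rw [← sub_eq_zero]
    -- Evaluated at $(x, y)$, the difference of comultiplication and tensor square is $\varphi(xy) -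
    -- \varphi(x)\varphi(y)$.
    refine eq_zero_of_forall_eval _ fun x y => ?_
    rw [map_sub, map_sub, h2]
    simp

namespace ProartinianHopf

/-! ### The simply transitive action of $N$ on embeddings -/

section Galois

variable {K H L E : Type*} [Field K] [Ring H] [Algebra K H] [TopologicalSpace H]
  {P : ProartinianHopf K H} [Field L] [Algebra K L] [Module H L] [IsScalarTower K H L]
  [Field E] [Algebra K E]

theorem LimN.π_toCompletedTensor (I : P.OpenHopfIdeal) (n : P.LimN E) :
    CompletedTensor.π I (LimN.toCompletedTensor n) = (LimN.π I n).val := rfl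

theorem LimN.ext {m n : P.LimN E} (h : ∀ I, LimN.π I m = LimN.π I n) : m = n :=
  Subtype.ext (funext h)

theorem LimN.toCompletedTensor_injective :
    Function.Injective (LimN.toCompletedTensor : P.LimN E → P.CompletedTensor E) := fun _ _ h =>
  LimN.ext fun I => GroupLike.val_injective (congrArg (CompletedTensor.π I) h)

theorem LimN.groupNMap_π {I J : P.OpenHopfIdeal} (hIJ : I ≤ J) (n : P.LimN E) :
    groupNMap E hIJ (LimN.π I n) = LimN.π J n := n.2 I J hIJ

/-- A completed tensor all of whose components are grouplike belongs to `N`. -/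
theorem LimN.exists_toCompletedTensor_eq (z : P.CompletedTensor E)
    (hz : ∀ I : P.OpenHopfIdeal, IsGroupLikeElem E (CompletedTensor.π I z)) :
    ∃ n : P.LimN E, LimN.toCompletedTensor n = z :=
  ⟨⟨fun I => ⟨CompletedTensor.π I z, hz I⟩, fun _ _ hIJ =>
    GroupLike.val_injective (CompletedTensor.baseFactor_π hIJ z)⟩, rfl⟩

-- Grouplike components turn the module algebra identities into multiplicativity and preservation of
-- $1$; all elements involved lie in some common $L^M$.
open OpenHopfIdeal in
theorem exists_homAct_toCompletedTensor [hL : IsDiscreteModuleAlgebra P L] (σ : L →ₐ[K] E)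
    (n : P.LimN E) : ∃ φ : L →ₐ[K] E,
      φ.toLinearMap = P.homAct σ.toLinearMap (LimN.toCompletedTensor n) := by
  refine ⟨AlgHom.ofLinearMap (P.homAct σ.toLinearMap (LimN.toCompletedTensor n)) ?_ ?_, rfl⟩
  · obtain ⟨I⟩ : Nonempty P.OpenHopfIdeal := inferInstance
    have h1 : (1 : L) ∈ I.fixed L := (I.fixedAlgebra L).one_mem
    rw [homAct_apply _ _ I _ h1, evalAct_one, LimN.π_toCompletedTensor]
    exact (LimN.π I n).2.counit_eq_one
  · intro x y
    obtain ⟨I, hI⟩ := exists_mem_fixed (P := P) x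
    obtain ⟨J, hJ⟩ := exists_mem_fixed (P := P) y
    obtain ⟨M, hMI, hMJ⟩ := OpenHopfIdeal.exists_le_le I J
    have hx := OpenHopfIdeal.fixed_mono hMI hI
    have hy := OpenHopfIdeal.fixed_mono hMJ hJ
    have hxy : x * y ∈ M.fixed L := (M.fixedAlgebra L).mul_mem hx hy
    rw [homAct_apply _ _ M _ hx, homAct_apply _ _ M _ hy, homAct_apply _ _ M _ hxy,
      evalAct_mul σ hx hy, LimN.π_toCompletedTensor, (LimN.π M n).2.comul_eq_tmul_self,
      TensorProduct.map_tmul, LinearMap.mul'_apply]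

variable [hG : P.IsHopfGalois L]

-- The converse of `exists_homAct_toCompletedTensor`. At a finer level $J$ the defect $\Delta w - w
-- \otimes w$ is killed by the level map tensored with itself, since $\varphi$ is multiplicative.
-- The pro-inverse $s$ then kills its image at level $I$.
open OpenHopfIdeal in
theorem isGroupLikeElem_of_homAct_eq (σ φ : L →ₐ[K] E) (z : P.CompletedTensor E)
    (hz : P.homAct σ.toLinearMap z = φ.toLinearMap) (I : P.OpenHopfIdeal) :
    IsGroupLikeElem E (CompletedTensor.π I z) := by
  obtain ⟨J, hJI, s, hs⟩ := I.exists_levelInverse σ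
  have := J.finite_fixedAlgebra L
  set w := CompletedTensor.π J z
  have hw : ∀ (x : L) (hx : x ∈ J.fixed L), J.evalAct σ.toLinearMap x hx w = φ x := fun x hx => by
    rw [← homAct_apply, hz]
    rfl
  have e : CompletedTensor.π I z = baseFactor E hJI w := (CompletedTensor.baseFactor_π hJI z).symm
  rw [e]
  constructor
  · have h1 : (1 : L) ∈ J.fixed L := (J.fixedAlgebra L).one_mem
    rw [CoalgHomClass.counit_comp_apply, ← evalAct_one σ h1, hw, map_one]
  · set q := J.levelEval σ.toLinearMap
    have h0 : TensorProduct.map q q (comul (R := E) w - w ⊗ₜ w) = 0 := by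
      refine eq_zero_of_forall_eval _ fun x y => ?_
      rw [← LinearMap.comp_apply (TensorProduct.map _ _), ← TensorProduct.map_comp]
      have hxy : x.1 * y.1 ∈ J.fixed L := (x * y).2
      have h1 := evalAct_mul σ x.2 y.2 hxy w
      rw [hw] at h1
      rw [map_sub, map_sub, TensorProduct.map_tmul, LinearMap.mul'_apply, sub_eq_zero]
      refine h1.symm.trans ?_
      rw [map_mul]
      exact congrArg₂ _ (hw x.1 x.2).symm (hw y.1 y.2).symm
    -- Although $s$ is merely linear, $s \circ q$ is the transition map, a coalgebra morphism; hence
    -- $(s \otimes s)(q \otimes q)$ commutes with comultiplication.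
    have hsq : s ∘ₗ q = (baseFactor E hJI).toCoalgHom.toLinearMap := LinearMap.ext hs
    have h2 := congrArg (TensorProduct.map s s) h0
    rw [← LinearMap.comp_apply, ← TensorProduct.map_comp, hsq, map_sub, map_zero, sub_eq_zero,
      TensorProduct.map_tmul] at h2
    exact (CoalgHomClass.map_comp_comul_apply (R := E) (baseFactor E hJI) w).symm.trans h2

theorem exists_limN_homAct_eq (σ φ : L →ₐ[K] E) :
    ∃ n : P.LimN E, P.homAct σ.toLinearMap (LimN.toCompletedTensor n) = φ.toLinearMap := by
  obtain ⟨z, hz⟩ := homAct_surjective (P := P) σ φ.toLinearMap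
  obtain ⟨n, rfl⟩ := LimN.exists_toCompletedTensor_eq z (isGroupLikeElem_of_homAct_eq σ φ z hz)
  exact ⟨n, hz⟩

/-- The algebra morphism `x ↦ σ · n` for `σ : L → E` and `n` in `N`. -/
noncomputable def algHomAct (σ : L →ₐ[K] E) (n : P.LimN E) : L →ₐ[K] E :=
  (exists_homAct_toCompletedTensor σ n).choose

theorem algHomAct_toLinearMap (σ : L →ₐ[K] E) (n : P.LimN E) : (algHomAct σ n).toLinearMap =
    P.homAct σ.toLinearMap (LimN.toCompletedTensor n) :=
  (exists_homAct_toCompletedTensor σ n).choose_spec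

theorem algHomAct_mul (σ : L →ₐ[K] E) (m n : P.LimN E) :
    algHomAct σ (m * n) = algHomAct (algHomAct σ m) n := by
  refine AlgHom.toLinearMap_injective ?_
  rw [algHomAct_toLinearMap, algHomAct_toLinearMap, algHomAct_toLinearMap, map_mul, homAct_mul]

theorem algHomAct_one (σ : L →ₐ[K] E) : algHomAct σ (1 : P.LimN E) = σ := by
  refine AlgHom.toLinearMap_injective ?_
  rw [algHomAct_toLinearMap, map_one, homAct_one]

/-- No normality of $E$ is needed: the embeddings of $L$ in any $E$ form a torsor under the
corresponding $N$, as soon as one of them exists. -/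
theorem algHomAct_bijective (σ : L →ₐ[K] E) :
    Function.Bijective (algHomAct σ : P.LimN E → (L →ₐ[K] E)) := by
  constructor
  · intro m n h
    refine LimN.toCompletedTensor_injective (homAct_injective σ ?_)
    rw [← algHomAct_toLinearMap, ← algHomAct_toLinearMap, h]
  · intro φ
    obtain ⟨n, hn⟩ := exists_limN_homAct_eq (P := P) σ φ
    exact ⟨n, AlgHom.toLinearMap_injective ((algHomAct_toLinearMap σ n).trans hn)⟩

/-- The component in `N_I` depends only on the restriction to some `L^J`. -/
theorem exists_forall_π_eq (σ : L →ₐ[K] E) (I : P.OpenHopfIdeal) : ∃ J : P.OpenHopfIdeal,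
    ∀ m n : P.LimN E, (∀ x ∈ J.fixed L, algHomAct σ m x = algHomAct σ n x) →
      LimN.π I m = LimN.π I n := by
  obtain ⟨J, hJI, hJ⟩ := I.exists_le_forall_levelEval σ
  refine ⟨J, fun m n h => ?_⟩
  refine GroupLike.val_injective ?_
  rw [← LimN.π_toCompletedTensor, ← LimN.π_toCompletedTensor,
    ← CompletedTensor.baseFactor_π hJI, ← CompletedTensor.baseFactor_π hJI, ← sub_eq_zero,
    ← map_sub]
  refine hJ _ (LinearMap.ext fun x => ?_)
  have := h x.1 x.2
  rw [map_sub, LinearMap.sub_apply, OpenHopfIdeal.levelEval_π, OpenHopfIdeal.levelEval_π,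
    ← algHomAct_toLinearMap, ← algHomAct_toLinearMap, LinearMap.zero_apply, sub_eq_zero]
  exact this

end Galois

/-! ### The groups $N_I$ over the normal closure -/

section NormalClosure

variable {K H L F : Type*} [Field K] [Ring H] [Algebra K H] [TopologicalSpace H]
  {P : ProartinianHopf K H} [Field L] [Algebra K L] [Module H L] [IsScalarTower K H L]
  [Field F] [Algebra K F] [Algebra.IsSeparable K L] [IsNormalClosure K L F]
  (I : P.OpenHopfIdeal)

variable (L) in
theorem OpenHopfIdeal.isField_fixedAlgebra [IsDiscreteModuleAlgebra P L] : IsField (I.fixedAlgebra L) :=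
  Subalgebra.isField_of_algebraic _

variable (L F) in
theorem OpenHopfIdeal.exists_basis_fixedAlgebra [P.IsHopfGalois L] :
    ∃ b : Module.Basis (I.fixedAlgebra L →ₐ[K] F) F (I.fixedAlgebra L →ₗ[K] F),
      ∀ φ, b φ = φ.toLinearMap := by
  have := I.finite_fixedAlgebra L
  -- Separability and splitting of minimal polynomials pass from elements of $L$ to elements of
  -- $L^I$.
  have e : ∀ a : I.fixedAlgebra L, minpoly K a.1 = minpoly K a :=
    minpoly.algHom_eq (I.fixedAlgebra L).val Subtype.val_injective
  refine exists_basis_algHom (I.isField_fixedAlgebra L) (fun a => ?_) fun a => ?_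
  · rw [IsSeparable, ← e]
    exact Algebra.IsSeparable.isSeparable K a.1
  · rw [← e]
    exact IsNormalClosure.splits _

variable [Algebra L F] [IsScalarTower K L F]

-- The pro-inverse $s$ sends $\mathrm{Hom}_K(L^J, F)$ onto $F \otimes H/I$, because transition maps
-- are onto. It therefore suffices that $s$ sends each embedding of $L^J$, a member of the basis, to
-- a component of an element of $N$.
variable (F) in
open OpenHopfIdeal in
theorem span_range_π (hG : P.IsHopfGalois L) : Submodule.span F
    (Set.range fun n : P.LimN F => (LimN.π I n).val) = ⊤ := by
  have := IsNormalClosure.normal (F := K) (K := L) (L := F)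
  let σ := IsScalarTower.toAlgHom K L F
  obtain ⟨J, hJI, s, hs⟩ := I.exists_levelInverse σ
  obtain ⟨b, hb⟩ := J.exists_basis_fixedAlgebra L F
  rw [eq_top_iff]
  rintro w -
  obtain ⟨w, rfl⟩ := baseFactor_surjective hJI w
  rw [← hs]
  have hle : Submodule.span F (Set.range b) ≤ (Submodule.span F
      (Set.range fun n : P.LimN F => (LimN.π I n).val)).comap s := by
    rw [Submodule.span_le]
    rintro _ ⟨φ, rfl⟩
    -- Normality of $F$ extends $\varphi$ from $L^J$ to the embedding $g\sigma$ of $L$, which is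
    -- $\sigma \cdot n$ for some $n \in N$.
    obtain ⟨g, hg⟩ := exists_algEquiv_extend (J.isField_fixedAlgebra L)
      (σ.comp (J.fixedAlgebra L).val) φ
    obtain ⟨n, hn⟩ := (algHomAct_bijective (P := P) σ).2 ((g : F →ₐ[K] F).comp σ)
    refine Submodule.subset_span ⟨n, ?_⟩
    have e : b φ = J.levelEval σ.toLinearMap (CompletedTensor.π J (LimN.toCompletedTensor n)) := by
      ext x
      rw [levelEval_π, ← algHomAct_toLinearMap, hn, hb]
      exact hg x
    dsimp only
    rw [e, hs, CompletedTensor.baseFactor_π]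
    rfl
  exact hle (b.span_eq ▸ Submodule.mem_top)

/-- Distinct grouplike elements are linearly independent, so one outside the image of $N$ could not
lie in the span of that image, which is everything. -/
theorem LimN.π_surjective (hG : P.IsHopfGalois L) : Function.Surjective (LimN.π I : P.LimN F → P.groupN F I) := by
  intro n
  by_contra h
  have h1 := (linearIndep_groupLikeVal (R := F) (A := F ⊗[K] I.Quot)).notMem_span_image
    (s := Set.range (LimN.π I : P.LimN F → P.groupN F I)) (x := n) h
  rw [← Set.range_comp] at h1
  exact h1 ((span_range_π F I hG).symm ▸ Submodule.mem_top)

variable (F) in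
theorem finite_groupN : Finite (P.groupN F I) := by
  have := I.finite_quot
  exact (linearIndep_groupLikeVal (R := F) (A := F ⊗[K] I.Quot)).finite

variable (F) in
/-- The Hopf algebra `F ⊗ H / I` is the group algebra of `N_I`. -/
theorem exists_groupAlgebra_equiv (hG : P.IsHopfGalois L) :
    ∃ e : MonoidAlgebra F (P.groupN F I) ≃ₐc[F] F ⊗[K] I.Quot,
      ∀ n : P.groupN F I, e (MonoidAlgebra.of F _ n) = n.val := by
  let f : MonoidAlgebra F (P.groupN F I) →ₐc[F] F ⊗[K] I.Quot :=
    MonoidAlgebra.liftGroupLikeBialgHom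
  have hf : ∀ n, f (MonoidAlgebra.of F _ n) = n.val := fun n => by
    simp [f]
  have h1 : Function.Injective f := by
    -- Injectivity is the linear independence of grouplike elements, and surjectivity is
    -- `span_range_π`.
    have key : ∀ x, f x = Finsupp.linearCombination F
        (GroupLike.val (R := F) (A := F ⊗[K] I.Quot)) x.coeff :=
      fun x => MonoidAlgebra.lift_apply _ x
    intro x y hxy
    rw [key, key] at hxy
    exact MonoidAlgebra.coeff_injective (linearIndep_groupLikeVal hxy)
  have h2 : LinearMap.range (f : MonoidAlgebra F (P.groupN F I) →ₗ[F] F ⊗[K] I.Quot) = ⊤ := by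
    rw [eq_top_iff, ← span_range_π F I hG, Submodule.span_le]
    rintro _ ⟨n, rfl⟩
    exact ⟨_, hf (LimN.π I n)⟩
  exact ⟨BialgEquiv.ofBijective f ⟨h1, LinearMap.range_eq_top.1 h2⟩, hf⟩

end NormalClosure
end ProartinianHopf
end HopfGalois

namespace HopfGalois

/-! ### Group algebras of quotients -/

section GroupAlgebra

variable {E N : Type*} [Field E] [Group N]

theorem domCongrBialgEquiv_of {G : Type*} [Group G] (q : N ≃* G) (n : N) :
    MonoidAlgebra.domCongrBialgEquiv E E q (MonoidAlgebra.of E N n) =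
      MonoidAlgebra.of E G (q n) := by
  simp [MonoidAlgebra.domCongrBialgEquiv]

variable (E) {A B C : Subgroup N} [A.Normal] [B.Normal] [C.Normal]

/-- The morphism between the group algebras of two quotients of a group. -/
noncomputable def quotientAlgebraMap (hAB : A ≤ B) :
    MonoidAlgebra E (N ⧸ A) →ₐc[E] MonoidAlgebra E (N ⧸ B) :=
  MonoidAlgebra.mapDomainBialgHom E (QuotientGroup.map A B (MonoidHom.id N) hAB)

variable {E}

theorem quotientAlgebraMap_of (hAB : A ≤ B) (n : N) :
    quotientAlgebraMap E hAB (MonoidAlgebra.of E _ (n : N ⧸ A)) =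
      MonoidAlgebra.of E _ (n : N ⧸ B) :=
  MonoidAlgebra.mapDomainBialgHom_single _ _ _

theorem quotientAlgebraMap_comp (hAB : A ≤ B) (hBC : B ≤ C) (hAC : A ≤ C)
    (y : MonoidAlgebra E (N ⧸ A)) :
    quotientAlgebraMap E hBC (quotientAlgebraMap E hAB y) = quotientAlgebraMap E hAC y := by
  rw [quotientAlgebraMap, quotientAlgebraMap, MonoidAlgebra.mapDomainBialgHom_mapDomainBialgHom,
    quotientAlgebraMap]
  congr 2
  ext
  rfl

theorem quotientAlgebraMap_self (y : MonoidAlgebra E (N ⧸ A)) :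
    quotientAlgebraMap E (le_refl A) y = y := by
  have h : QuotientGroup.map A A (MonoidHom.id N) le_rfl = MonoidHom.id _ := by
    ext
    rfl
  rw [quotientAlgebraMap, h, MonoidAlgebra.mapDomainBialgHom_id, BialgHom.id_apply]

variable [TopologicalSpace N]

theorem CompletedGroupAlgebra.quotientAlgebraMap_π {M M' : OpenNormalSubgroup N}
    (h : M.toSubgroup ≤ M'.toSubgroup) (x : CompletedGroupAlgebra E N) :
    quotientAlgebraMap E h (CompletedGroupAlgebra.π M x) = CompletedGroupAlgebra.π M' x :=
  CompletedGroupAlgebra.map_π h x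

/-- The element of the completed group algebra given by a compatible family. -/
noncomputable def CompletedGroupAlgebra.mk
    (x : ∀ M : OpenNormalSubgroup N, MonoidAlgebra E (N ⧸ M.toSubgroup))
    (hx : ∀ (M M' : OpenNormalSubgroup N) (h : M.toSubgroup ≤ M'.toSubgroup),
      quotientAlgebraMap E h (x M) = x M') : CompletedGroupAlgebra E N :=
  ⟨x, hx⟩

theorem CompletedGroupAlgebra.π_mk
    (x : ∀ M : OpenNormalSubgroup N, MonoidAlgebra E (N ⧸ M.toSubgroup))
    (hx : ∀ (M M' : OpenNormalSubgroup N) (h : M.toSubgroup ≤ M'.toSubgroup),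
      quotientAlgebraMap E h (x M) = x M') (M : OpenNormalSubgroup N) :
    CompletedGroupAlgebra.π M (CompletedGroupAlgebra.mk x hx) = x M := rfl

end GroupAlgebra

namespace ProartinianHopf

/-! ### $N$ as a profinite group and its completed group algebra -/

section LimitGroup

variable {K H E : Type*} [Field K] [Ring H] [Algebra K H] [TopologicalSpace H]
  {P : ProartinianHopf K H} [Field E] [Algebra K E]

instance LimN.isTopologicalGroup : IsTopologicalGroup (P.LimN E) := by
  refine topologicalGroup_iInf fun I => ?_
  let _ : TopologicalSpace (P.groupN E I) := ⊥
  have : DiscreteTopology (P.groupN E I) := ⟨rfl⟩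
  exact topologicalGroup_induced (LimN.π I)

theorem LimN.nhds_hasBasis (n : P.LimN E) : (nhds n).HasBasis (fun _ : P.OpenHopfIdeal => True)
    (fun I => {m | LimN.π I m = LimN.π I n}) :=
  nhds_iInf_induced (fun I : P.OpenHopfIdeal => (LimN.π (E := E) I : _ → _)) n fun I J => by
    obtain ⟨M, hI, hJ⟩ := OpenHopfIdeal.exists_le_le I J
    refine ⟨M, fun m hm => ⟨?_, ?_⟩⟩
    · rw [← LimN.groupNMap_π hI, hm, LimN.groupNMap_π]
    · rw [← LimN.groupNMap_π hJ, hm, LimN.groupNMap_π]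

theorem LimN.isOpen_π_eq (I : P.OpenHopfIdeal) (y : P.groupN E I) :
    IsOpen {m : P.LimN E | LimN.π I m = y} :=
  isOpen_iInf_induced (fun I : P.OpenHopfIdeal => (LimN.π (E := E) I : _ → _)) I y

instance LimN.t2Space : T2Space (P.LimN E) := by
  refine ⟨fun m n hmn => ?_⟩
  obtain ⟨I, hI⟩ : ∃ I, LimN.π I m ≠ LimN.π I n := by
    by_contra! h
    exact hmn (LimN.ext h)
  refine ⟨_, _, LimN.isOpen_π_eq I (LimN.π I m), LimN.isOpen_π_eq I (LimN.π I n), rfl, rfl, ?_⟩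
  exact Set.disjoint_left.2 fun x hx hx' => hI (hx.symm.trans hx')

instance LimN.totallyDisconnectedSpace : TotallyDisconnectedSpace (P.LimN E) := by
  let _ : ∀ I : P.OpenHopfIdeal, TopologicalSpace (P.groupN E I) := fun _ => ⊥
  have : ∀ I : P.OpenHopfIdeal, DiscreteTopology (P.groupN E I) := fun _ => ⟨rfl⟩
  refine ⟨?_⟩
  refine isTotallyDisconnected_of_image (f := fun (n : P.LimN E) I => LimN.π I n)
    ?_ (fun m n h => LimN.ext fun I => congrFun h I)
    (isTotallyDisconnected_of_totallyDisconnectedSpace _)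
  exact (continuous_pi fun I => continuous_iInf_dom (i := I) continuous_induced_dom).continuousOn

theorem LimN.compactSpace (hfin : ∀ I : P.OpenHopfIdeal, Finite (P.groupN E I)) :
    CompactSpace (P.LimN E) := by
  let _ : ∀ I : P.OpenHopfIdeal, TopologicalSpace (P.groupN E I) := fun _ => ⊥
  have : ∀ I : P.OpenHopfIdeal, DiscreteTopology (P.groupN E I) := fun _ => ⟨rfl⟩
  have hi : Topology.IsInducing (fun (n : P.LimN E) (I : P.OpenHopfIdeal) => LimN.π I n) :=
    inducing_iInf_to_pi fun (I : P.OpenHopfIdeal) (n : P.LimN E) => LimN.π I n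
  -- Inside the compact product of the finite discrete $N_I$, the group $N$ is cut out by equalities
  -- of continuous maps, hence closed.
  have hr : Set.range (fun (n : P.LimN E) (I : P.OpenHopfIdeal) => LimN.π I n) =
      ⋂ (I : P.OpenHopfIdeal) (J : P.OpenHopfIdeal) (hIJ : I ≤ J),
        {x | groupNMap E hIJ (x I) = x J} := by
    ext x
    simp only [Set.mem_iInter, Set.mem_ofPred_eq]
    constructor
    · rintro ⟨n, rfl⟩ I J hIJ
      exact LimN.groupNMap_π hIJ n
    · exact fun hx => ⟨⟨x, hx⟩, rfl⟩
  have hc : IsClosed (Set.range (fun (n : P.LimN E) (I : P.OpenHopfIdeal) => LimN.π I n)) := by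
    rw [hr]
    refine isClosed_iInter fun I => isClosed_iInter fun J => isClosed_iInter fun hIJ => ?_
    exact isClosed_eq (continuous_of_discreteTopology.comp (continuous_apply I))
      (continuous_apply J)
  exact (Topology.IsClosedEmbedding.mk ⟨hi, fun m n h => LimN.ext fun I => congrFun h I⟩
    hc).compactSpace

/-- The kernel of the projection `N → N_I`. -/
noncomputable def LimN.kerOpen (E : Type*) [Field E] [Algebra K E] (I : P.OpenHopfIdeal) :
    OpenNormalSubgroup (P.LimN E) where
  toSubgroup := (LimN.π I).ker
  isOpen' := LimN.isOpen_π_eq (E := E) I 1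
  isNormal' := inferInstance

theorem LimN.kerOpen_mono {I J : P.OpenHopfIdeal} (hIJ : I ≤ J) :
    (LimN.kerOpen E I).toSubgroup ≤ (LimN.kerOpen E J).toSubgroup := fun n hn => by
  have h : LimN.π I n = 1 := hn
  change LimN.π J n = 1
  rw [← LimN.groupNMap_π hIJ, h, map_one]

/-- The kernels of $N \to N_I$ are cofinal among the open normal subgroups. This is what allows the
two limits, over $I$ and over $M$, to be compared. -/
theorem LimN.exists_kerOpen_le (M : OpenNormalSubgroup (P.LimN E)) :
    ∃ I : P.OpenHopfIdeal, (LimN.kerOpen E I).toSubgroup ≤ M.toSubgroup := by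
  obtain ⟨I, -, hI⟩ := (LimN.nhds_hasBasis (1 : P.LimN E)).mem_iff.1
    (M.isOpen'.mem_nhds M.one_mem')
  exact ⟨I, fun n hn => hI (show LimN.π I n = LimN.π I 1 from
    (show LimN.π I n = 1 from hn).trans (map_one _).symm)⟩

theorem exists_quotient_groupAlgebra_equiv (I : P.OpenHopfIdeal)
    (hsurj : Function.Surjective (LimN.π I : P.LimN E → P.groupN E I))
    (he : ∃ e : MonoidAlgebra E (P.groupN E I) ≃ₐc[E] E ⊗[K] I.Quot,
      ∀ n : P.groupN E I, e (MonoidAlgebra.of E _ n) = n.val) :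
    ∃ e : MonoidAlgebra E (P.LimN E ⧸ (LimN.π I : P.LimN E →* P.groupN E I).ker) ≃ₐc[E]
        E ⊗[K] I.Quot,
      ∀ n : P.LimN E, e (MonoidAlgebra.of E _ n) = (LimN.π I n).val := by
  obtain ⟨e, he⟩ := he
  let q := QuotientGroup.quotientKerEquivOfSurjective
    (LimN.π I : P.LimN E →* P.groupN E I) hsurj
  refine ⟨(MonoidAlgebra.domCongrBialgEquiv E E q).trans e, fun n => ?_⟩
  have h := domCongrBialgEquiv_of (E := E) q n
  have h2 : q n = LimN.π I n := rfl
  rw [h2] at h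
  exact (congrArg e h).trans (he _)

section CompletedGroupAlgebra

variable (e : ∀ I : P.OpenHopfIdeal,
    MonoidAlgebra E (P.LimN E ⧸ (LimN.kerOpen E I).toSubgroup) ≃ₐc[E] E ⊗[K] I.Quot)
  (he : ∀ (I : P.OpenHopfIdeal) (n : P.LimN E),
    e I (MonoidAlgebra.of E _ (n : P.LimN E ⧸ (LimN.kerOpen E I).toSubgroup)) =
      (LimN.π I n).val)

include he in
theorem baseFactor_groupAlgebra_equiv {I J : P.OpenHopfIdeal} (hIJ : I ≤ J)
    (y : MonoidAlgebra E (P.LimN E ⧸ (LimN.kerOpen E I).toSubgroup)) :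
    OpenHopfIdeal.baseFactor E hIJ (e I y) =
      e J (quotientAlgebraMap E (LimN.kerOpen_mono hIJ) y) := by
  induction y using MonoidAlgebra.induction_on with
  | of g =>
    obtain ⟨n, rfl⟩ := QuotientGroup.mk_surjective g
    rw [he, quotientAlgebraMap_of, he, ← LimN.groupNMap_π hIJ]
    rfl
  | add x y hx hy => simp only [map_add, hx, hy]
  | smul r x hx => simp only [map_smul, hx]

/-- The map from the completed group algebra of `N` to the completed tensor product. -/
noncomputable def ofCompletedGroupAlgebra :
    CompletedGroupAlgebra E (P.LimN E) →ₐ[E] P.CompletedTensor E :=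
  AlgHom.ofLinearMap
    { toFun := fun x => CompletedTensor.mk
        (fun I => e I (CompletedGroupAlgebra.π (LimN.kerOpen E I) x)) fun I J hIJ => by
          rw [baseFactor_groupAlgebra_equiv e he hIJ, CompletedGroupAlgebra.quotientAlgebraMap_π]
      map_add' := fun x y => CompletedTensor.ext fun I => by
        simp only [CompletedTensor.π_mk, map_add]
      map_smul' := fun r x => CompletedTensor.ext fun I => by
        simp only [CompletedTensor.π_mk, map_smul, RingHom.id_apply] }
    (CompletedTensor.ext fun I => by
      simp only [LinearMap.coe_mk, AddHom.coe_mk, CompletedTensor.π_mk, map_one])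
    (fun x y => CompletedTensor.ext fun I => by
      simp only [LinearMap.coe_mk, AddHom.coe_mk, CompletedTensor.π_mk, map_mul])

theorem π_ofCompletedGroupAlgebra (I : P.OpenHopfIdeal) (x : CompletedGroupAlgebra E (P.LimN E)) :
    CompletedTensor.π I (ofCompletedGroupAlgebra e he x) =
      e I (CompletedGroupAlgebra.π (LimN.kerOpen E I) x) := rfl

theorem ofCompletedGroupAlgebra_bijective :
    Function.Bijective (ofCompletedGroupAlgebra e he) := by
  constructor
  · rw [injective_iff_map_eq_zero]
    intro x hx
    refine CompletedGroupAlgebra.ext fun M => ?_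
    obtain ⟨I, hI⟩ := LimN.exists_kerOpen_le M
    have h := congrArg (CompletedTensor.π I) hx
    rw [π_ofCompletedGroupAlgebra, map_zero, EmbeddingLike.map_eq_zero_iff] at h
    rw [← CompletedGroupAlgebra.quotientAlgebraMap_π hI, h, map_zero, map_zero]
  · intro z
    choose I hI using fun M : OpenNormalSubgroup (P.LimN E) => LimN.exists_kerOpen_le M
    have hsymm : ∀ (I J : P.OpenHopfIdeal) (hIJ : I ≤ J),
        quotientAlgebraMap E (LimN.kerOpen_mono hIJ) ((e I).symm (CompletedTensor.π I z)) =
          (e J).symm (CompletedTensor.π J z) := by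
      intro I J hIJ
      apply EquivLike.injective (e J)
      rw [← baseFactor_groupAlgebra_equiv e he hIJ, BialgEquiv.apply_symm_apply,
        BialgEquiv.apply_symm_apply, CompletedTensor.baseFactor_π]
    -- The component of the preimage at $M$ is independent of the index $I$ used to compute it.
    have key : ∀ (M : OpenNormalSubgroup (P.LimN E)) (I J : P.OpenHopfIdeal)
        (hI : (LimN.kerOpen E I).toSubgroup ≤ M.toSubgroup)
        (hJ : (LimN.kerOpen E J).toSubgroup ≤ M.toSubgroup),
        quotientAlgebraMap E hI ((e I).symm (CompletedTensor.π I z)) =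
          quotientAlgebraMap E hJ ((e J).symm (CompletedTensor.π J z)) := by
      intro M I J hI hJ
      obtain ⟨D, hDI, hDJ⟩ := OpenHopfIdeal.exists_le_le I J
      have hD := (LimN.kerOpen_mono (E := E) hDI).trans hI
      rw [← hsymm D I hDI, ← hsymm D J hDJ, quotientAlgebraMap_comp _ _ hD,
        quotientAlgebraMap_comp _ _ hD]
    refine ⟨CompletedGroupAlgebra.mk (fun M =>
      quotientAlgebraMap E (hI M) ((e (I M)).symm (CompletedTensor.π (I M) z))) fun M M' h => ?_,
      CompletedTensor.ext fun J => ?_⟩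
    · rw [key M' (I M') (I M) (hI M') ((hI M).trans h), quotientAlgebraMap_comp]
    -- For $M$ the kernel of $N \to N_J$, the index $J$ itself may replace the chosen one.
    · rw [π_ofCompletedGroupAlgebra, CompletedGroupAlgebra.π_mk, key _ _ J _ le_rfl,
        quotientAlgebraMap_self, BialgEquiv.apply_symm_apply]

include he in
/-- The completed group algebra of `N` is isomorphic to the completed tensor product, if this
holds for all quotients. -/
theorem exists_completedGroupAlgebra_equiv [CompactSpace (P.LimN E)] :
    ∃ f : CompletedGroupAlgebra E (P.LimN E) ≃ₐ[E] P.CompletedTensor E,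
      (completedGroupAlgebra E (P.LimN E)).IsMorphism (P.completedTensor E) f.toLinearMap ∧
      (P.completedTensor E).IsMorphism (completedGroupAlgebra E (P.LimN E))
        f.symm.toLinearMap ∧
      ∀ n : P.LimN E, f (CompletedGroupAlgebra.of n) = LimN.toCompletedTensor n := by
  refine ⟨AlgEquiv.ofBijective _ (ofCompletedGroupAlgebra_bijective e he),
    fun (I : P.OpenHopfIdeal) => ?_, fun (M : OpenNormalSubgroup (P.LimN E)) => ?_,
    fun n => CompletedTensor.ext fun I => he I n⟩
  · let t : MonoidAlgebra E (P.LimN E ⧸ (LimN.kerOpen E I).toSubgroup) →ₐc[E] E ⊗[K] I.Quot := e I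
    exact ⟨LimN.kerOpen E I, t, fun x => rfl⟩
  · obtain ⟨I, hI⟩ := LimN.exists_kerOpen_le M
    let t : E ⊗[K] I.Quot →ₐc[E] MonoidAlgebra E (P.LimN E ⧸ (LimN.kerOpen E I).toSubgroup) :=
      (e I).symm
    let t' : E ⊗[K] I.Quot →ₐc[E] MonoidAlgebra E (P.LimN E ⧸ M.toSubgroup) :=
      (quotientAlgebraMap E hI).comp t
    refine ⟨I, t', fun z => ?_⟩
    obtain ⟨x, rfl⟩ := (ofCompletedGroupAlgebra_bijective e he).2 z
    have h1 : (AlgEquiv.ofBijective _ (ofCompletedGroupAlgebra_bijective e he)).symm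
        (ofCompletedGroupAlgebra e he x) = x :=
      (AlgEquiv.ofBijective _ (ofCompletedGroupAlgebra_bijective e he)).symm_apply_apply x
    refine Eq.trans ?_ (congrArg (CompletedGroupAlgebra.π M) h1).symm
    refine Eq.trans ?_ (CompletedGroupAlgebra.quotientAlgebraMap_π hI x)
    exact congrArg (quotientAlgebraMap E hI) ((e I).symm_apply_apply _)

end CompletedGroupAlgebra

end LimitGroup

end ProartinianHopf
end HopfGalois

/-! ### The Galois action on $N$ -/

namespace HopfGalois
namespace ProartinianHopf

/-- The normal closure is generated by the images of $L$, whose elements have the same separable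
minimal polynomials as elements of $L$. -/
theorem isGalois_of_isNormalClosure (K L F : Type*) [Field K] [Field L] [Algebra K L]
    [Algebra.IsSeparable K L] [Field F] [Algebra K F] [IsNormalClosure K L F] : IsGalois K F := by
  have h1 := (Algebra.IsAlgebraic.isNormalClosure_iff (F := K) (K := L) (L := F)).1 inferInstance
  have h2 : IntermediateField.normalClosure K L F ≤ separableClosure K F := by
    rw [normalClosure_le_iff]
    rintro f _ ⟨x, rfl⟩
    have h : minpoly K (f x) = minpoly K x := minpoly.algHom_eq f f.injective x
    refine mem_separableClosure_iff.2 (?_ : (minpoly K (f x)).Separable)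
    rw [h]
    exact Algebra.IsSeparable.isSeparable K x
  have : Algebra.IsSeparable K F := ⟨fun y =>
    mem_separableClosure_iff.1 (h2 (h1.2 ▸ IntermediateField.mem_top))⟩
  have := IsNormalClosure.normal (F := K) (K := L) (L := F)
  exact {}

/-- The stabilizer of an algebraic element is open in the Krull topology, so evaluation at $x$ is
locally constant. All the continuity statements about $G$ below rest on this. -/
theorem mem_nhds_apply_eq {K F : Type*} [Field K] [Field F] [Algebra K F]
    [Algebra.IsIntegral K F] (g : Gal(F/K)) (x : F) : ∀ᶠ g' : Gal(F/K) in nhds g, g' x = g x := by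
  have ho : IsOpen (MulAction.stabilizer Gal(F/K) x : Set Gal(F/K)) :=
    stabilizer_isOpen_of_isIntegral x
  filter_upwards [(ho.leftCoset g).mem_nhds ⟨1, one_mem _, mul_one g⟩]
  rintro _ ⟨k, hk, rfl⟩
  exact congrArg g hk

section

variable {K H L E F : Type*} [Field K] [Ring H] [Algebra K H] [TopologicalSpace H]
  {P : ProartinianHopf K H} [Field L] [Algebra K L] [Module H L] [IsScalarTower K H L]
  [Field E] [Algebra K E] [Field F] [Algebra K F]

/-- The map `E ⊗̂ H → F ⊗̂ H` induced by a morphism `E → F`. -/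
noncomputable def CompletedTensor.mapCoeff (τ : E →ₐ[K] F) (z : P.CompletedTensor E) :
    P.CompletedTensor F :=
  CompletedTensor.mk (fun I => I.mapCoeff τ (CompletedTensor.π I z)) fun I J hIJ => by
    rw [OpenHopfIdeal.baseFactor_mapCoeff, CompletedTensor.baseFactor_π]

theorem homAct_mapCoeff [IsDiscreteModuleAlgebra P L] (τ : E →ₐ[K] F) (f : L →ₗ[K] E)
    (z : P.CompletedTensor E) :
    P.homAct (τ.toLinearMap ∘ₗ f) (CompletedTensor.mapCoeff τ z) =
      τ.toLinearMap ∘ₗ P.homAct f z := by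
  ext x
  obtain ⟨I, hx⟩ := exists_mem_fixed (P := P) x
  have h := OpenHopfIdeal.levelEval_mapCoeff τ f (CompletedTensor.π I z) ⟨x, hx⟩
  rw [OpenHopfIdeal.levelEval_π] at h
  rw [homAct_apply _ _ I x hx]
  exact h

/-- The map $\tau \otimes \mathrm{id}$ is only semilinear, so preservation of grouplike elements is
read off from embeddings: it carries $\sigma \cdot n$ to $\tau \circ (\sigma \cdot n)$, which is
again an algebra morphism. -/
theorem isGroupLikeElem_mapCoeff (hG : P.IsHopfGalois L) (σ : L →ₐ[K] E) (τ : E →ₐ[K] F)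
    (n : P.LimN E) (I : P.OpenHopfIdeal) :
    IsGroupLikeElem F (I.mapCoeff τ (LimN.π I n).val) := by
  refine isGroupLikeElem_of_homAct_eq (τ.comp σ) (τ.comp (algHomAct σ n))
    (CompletedTensor.mapCoeff τ (LimN.toCompletedTensor n)) ?_ I
  refine (homAct_mapCoeff τ σ.toLinearMap _).trans ?_
  rw [← algHomAct_toLinearMap]
  rfl

theorem mapCoeff_groupLike_compatible (g : E →ₐ[K] F) (n : P.LimN E) (I J : P.OpenHopfIdeal)
    (hIJ : I ≤ J) : OpenHopfIdeal.baseFactor F hIJ (I.mapCoeff g (LimN.π I n).val) =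
      J.mapCoeff g (LimN.π J n).val := by
  rw [OpenHopfIdeal.baseFactor_mapCoeff, ← LimN.groupNMap_π hIJ]
  rfl

/-- The action of the Galois group on `N`, through the first tensor factor. -/
noncomputable abbrev galoisAction (h : ∀ (g : Gal(F/K)) (n : P.LimN F) (I : P.OpenHopfIdeal),
    IsGroupLikeElem F (I.mapCoeff (g : F →ₐ[K] F) (LimN.π I n).val)) :
    MulDistribMulAction Gal(F/K) (P.LimN F) where
  smul g n := ⟨fun I => ⟨_, h g n I⟩, fun I J hIJ =>
    GroupLike.val_injective (mapCoeff_groupLike_compatible (g : F →ₐ[K] F) n I J hIJ)⟩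
  one_smul n := LimN.ext fun I => GroupLike.val_injective <| by
    change I.mapCoeff ((1 : Gal(F/K)) : F →ₐ[K] F) (LimN.π I n).val = _
    have e : I.mapCoeff ((1 : Gal(F/K)) : F →ₐ[K] F) = AlgHom.id K _ :=
      Algebra.TensorProduct.map_id
    rw [e, AlgHom.id_apply]
  mul_smul g g' n := LimN.ext fun I => GroupLike.val_injective <| by
    change I.mapCoeff ((g * g' : Gal(F/K)) : F →ₐ[K] F) (LimN.π I n).val =
      I.mapCoeff (g : F →ₐ[K] F) (I.mapCoeff (g' : F →ₐ[K] F) (LimN.π I n).val)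
    have e : I.mapCoeff ((g * g' : Gal(F/K)) : F →ₐ[K] F) =
        (I.mapCoeff (g : F →ₐ[K] F)).comp (I.mapCoeff (g' : F →ₐ[K] F)) := by
      ext <;> simp
    rw [e, AlgHom.comp_apply]
  smul_mul g m n := LimN.ext fun I => GroupLike.val_injective
    (map_mul (I.mapCoeff (g : F →ₐ[K] F)) (LimN.π I m).val (LimN.π I n).val)
  smul_one g := LimN.ext fun I => GroupLike.val_injective (map_one (I.mapCoeff (g : F →ₐ[K] F)))

theorem galoisAction_π (h : ∀ (g : Gal(F/K)) (n : P.LimN F) (I : P.OpenHopfIdeal),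
    IsGroupLikeElem F (I.mapCoeff (g : F →ₐ[K] F) (LimN.π I n).val)) (g : Gal(F/K))
    (n : P.LimN F) (I : P.OpenHopfIdeal) :
    letI := galoisAction h
    (LimN.π I (g • n)).val = I.mapCoeff (g : F →ₐ[K] F) (LimN.π I n).val := rfl

/-- A tensor involves finitely many coefficients from $F$, and each is moved in a locally constant
way. -/
theorem eventually_mapCoeff_eq [Algebra.IsIntegral K F] (I : P.OpenHopfIdeal) (g : Gal(F/K))
    (z : F ⊗[K] I.Quot) : ∀ᶠ g' : Gal(F/K) in nhds g,
      I.mapCoeff (g' : F →ₐ[K] F) z = I.mapCoeff (g : F →ₐ[K] F) z := by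
  induction z using TensorProduct.induction_on with
  | zero => simp
  | tmul y b =>
    filter_upwards [mem_nhds_apply_eq g y] with g' hg'
    simp [hg']
  | add z w hz hw =>
    filter_upwards [hz, hw] with g' hz' hw'
    rw [map_add, map_add, hz', hw']

theorem continuousSMul_galoisAction [Algebra.IsIntegral K F]
    (h : ∀ (g : Gal(F/K)) (n : P.LimN F) (I : P.OpenHopfIdeal),
      IsGroupLikeElem F (I.mapCoeff (g : F →ₐ[K] F) (LimN.π I n).val)) :
    letI := galoisAction h
    ContinuousSMul Gal(F/K) (P.LimN F) := by
  let _ := galoisAction h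
  refine ⟨continuous_iff_continuousAt.2 fun ⟨g, n⟩ => ?_⟩
  refine (LimN.nhds_hasBasis (g • n)).tendsto_right_iff.2 fun I _ => ?_
  rw [nhds_prod_eq]
  filter_upwards [(eventually_mapCoeff_eq I g (LimN.π I n).val).prod_mk
    ((LimN.nhds_hasBasis n).mem_of_mem (i := I) trivial)]
  rintro ⟨g', n'⟩ ⟨hg', hn'⟩
  refine GroupLike.val_injective ?_
  change I.mapCoeff (g' : F →ₐ[K] F) (LimN.π I n').val = I.mapCoeff (g : F →ₐ[K] F) (LimN.π I n).val
  have hn : LimN.π I n' = LimN.π I n := hn'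
  rw [hn]
  exact hg'

/-- The source of the identity $g \cdot ((hG') \cdot n) = (ghG') \cdot (g \cdot n)$, at the level of
embeddings. -/
theorem algHomAct_galoisAction [hG : P.IsHopfGalois L]
    (h : ∀ (g : Gal(F/K)) (n : P.LimN F) (I : P.OpenHopfIdeal),
      IsGroupLikeElem F (I.mapCoeff (g : F →ₐ[K] F) (LimN.π I n).val)) (g : Gal(F/K))
    (n : P.LimN F) (φ : L →ₐ[K] F) :
    letI := galoisAction h
    algHomAct ((g : F →ₐ[K] F).comp φ) (g • n) = (g : F →ₐ[K] F).comp (algHomAct φ n) := by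
  refine AlgHom.toLinearMap_injective ?_
  rw [algHomAct_toLinearMap]
  refine (homAct_mapCoeff (g : F →ₐ[K] F) φ.toLinearMap (LimN.toCompletedTensor n)).trans ?_
  rw [← algHomAct_toLinearMap]
  rfl

end

/-! ### Cosets as embeddings, and the homeomorphism $\beta$ -/

section Quotient

variable {K L F : Type*} [Field K] [Field L] [Algebra K L] [Field F] [Algebra K F] [Normal K F]

/-- The quotient of the Galois group by the stabilizer of a subextension is the set of
embeddings. -/
theorem exists_quotient_equiv_algHom (σ : L →ₐ[K] F) :
    ∃ δ : Gal(F/K) ⧸ σ.fieldRange.fixingSubgroup ≃ (L →ₐ[K] F),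
      ∀ g : Gal(F/K), δ g = (g : F →ₐ[K] F).comp σ := by
  -- Two automorphisms lie in the same coset exactly when they agree on $\sigma(L)$. Surjectivity
  -- below is the normality of $F$.
  have key : ∀ g h : Gal(F/K), ((g : Gal(F/K) ⧸ σ.fieldRange.fixingSubgroup) = h) ↔
      (g : F →ₐ[K] F).comp σ = (h : F →ₐ[K] F).comp σ := by
    intro g h
    rw [QuotientGroup.eq, IntermediateField.mem_fixingSubgroup_iff]
    constructor
    · intro hgh
      ext x
      have := hgh (σ x) ⟨x, rfl⟩
      rw [AlgEquiv.mul_apply, AlgEquiv.aut_inv, AlgEquiv.symm_apply_eq] at this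
      exact this.symm
    · rintro hgh _ ⟨x, rfl⟩
      rw [AlgEquiv.mul_apply, AlgEquiv.aut_inv, AlgEquiv.symm_apply_eq]
      exact (DFunLike.congr_fun hgh x).symm
  let f : Gal(F/K) ⧸ σ.fieldRange.fixingSubgroup → (L →ₐ[K] F) :=
    Quotient.lift (fun g : Gal(F/K) => (g : F →ₐ[K] F).comp σ) fun g h hgh =>
      (key g h).1 (Quotient.sound hgh)
  refine ⟨Equiv.ofBijective f ⟨?_, fun φ => ?_⟩, fun g => rfl⟩
  · intro a b hab
    obtain ⟨g, rfl⟩ := QuotientGroup.mk_surjective a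
    obtain ⟨h, rfl⟩ := QuotientGroup.mk_surjective b
    exact (key g h).2 hab
  · obtain ⟨g, hg⟩ := exists_algEquiv_extend (Field.toIsField L) σ φ
    exact ⟨g, (AlgHom.ext hg).symm⟩

end Quotient

section

variable {K H L F : Type*} [Field K] [Ring H] [Algebra K H] [TopologicalSpace H]
  {P : ProartinianHopf K H} [Field L] [Algebra K L] [Module H L] [IsScalarTower K H L]
  [Field F] [Algebra K F] [hG : P.IsHopfGalois L]

/-- The component of $\psi(g)$ in $N_I$ depends only on $g\sigma$ restricted to some
finite-dimensional $L^J$, hence on the values of $g$ at finitely many elements. -/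
theorem continuous_of_algHomAct_eq [Algebra.IsIntegral K F] (σ : L →ₐ[K] F)
    (ψ : Gal(F/K) → P.LimN F)
    (hψ : ∀ g, algHomAct σ (ψ g) = (g : F →ₐ[K] F).comp σ) : Continuous ψ := by
  refine continuous_iff_continuousAt.2 fun g => ?_
  refine (LimN.nhds_hasBasis (ψ g)).tendsto_right_iff.2 fun I _ => ?_
  obtain ⟨J, hJ⟩ := exists_forall_π_eq σ I
  have := J.finite_fixedAlgebra L
  let b := Module.finBasis K (J.fixedAlgebra L)
  filter_upwards [Filter.eventually_all.2 fun i => mem_nhds_apply_eq g (σ (b i).1)] with g' hg'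
  refine hJ _ _ fun x hx => ?_
  rw [hψ, hψ]
  have h : (((g' : F →ₐ[K] F).comp σ).comp (J.fixedAlgebra L).val).toLinearMap =
      (((g : F →ₐ[K] F).comp σ).comp (J.fixedAlgebra L).val).toLinearMap :=
    b.ext hg'
  exact LinearMap.congr_fun h ⟨x, hx⟩

theorem exists_homeomorph [IsGalois K F] (σ : L →ₐ[K] F) [CompactSpace Gal(F/K)]
    (δ : Gal(F/K) ⧸ σ.fieldRange.fixingSubgroup ≃ (L →ₐ[K] F))
    (hδ : ∀ g : Gal(F/K), δ g = (g : F →ₐ[K] F).comp σ) :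
    ∃ β : P.LimN F ≃ₜ Gal(F/K) ⧸ σ.fieldRange.fixingSubgroup,
      ∀ n, δ (β n) = algHomAct σ n := by
  let γ : Gal(F/K) ⧸ σ.fieldRange.fixingSubgroup ≃ P.LimN F :=
    δ.trans (Equiv.ofBijective _ (algHomAct_bijective (P := P) σ)).symm
  have hγ : ∀ q, algHomAct σ (γ q) = δ q := fun q =>
    (Equiv.ofBijective _ (algHomAct_bijective (P := P) σ)).apply_symm_apply (δ q)
  -- Continuity is easy in the direction $G/G' \to N$, since it can be checked on $G$. Compactness
  -- of the source and the Hausdorff property of $N$ give the inverse.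
  have hc : Continuous γ := by
    refine continuous_coinduced_dom.2 ?_
    exact continuous_of_algHomAct_eq σ _ fun g => (hγ g).trans (hδ g)
  refine ⟨(hc.homeoOfEquivCompactToT2).symm, fun n => ?_⟩
  rw [← hγ]
  exact congrArg (algHomAct σ) (γ.apply_symm_apply n)

/-- The right action of `N` on the embeddings of `L`, transported to cosets. -/
noncomputable abbrev cosetAction {X : Type*} (δ : X ≃ (L →ₐ[K] F)) : MulAction (P.LimN F)ᵐᵒᵖ X where
  smul n q := δ.symm (algHomAct (δ q) n.unop)
  one_smul q := by
    change δ.symm (algHomAct (δ q) 1) = q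
    rw [algHomAct_one, Equiv.symm_apply_apply]
  mul_smul m n q := by
    change δ.symm (algHomAct (δ q) (n.unop * m.unop)) =
      δ.symm (algHomAct (δ (δ.symm (algHomAct (δ q) n.unop))) m.unop)
    rw [algHomAct_mul, Equiv.apply_symm_apply]

end
end ProartinianHopf
end HopfGalois

/-! ### The main theorem -/

theorem mainTheorem5 {K H L Lt : Type*} [Field K] [Ring H] [Algebra K H] [TopologicalSpace H]
    (P : HopfGalois.ProartinianHopf K H)
    [Field L] [Algebra K L] [Module H L] [IsScalarTower K H L] [P.IsHopfGalois L]
    [Algebra.IsSeparable K L]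
    [Field Lt] [Algebra K Lt] [Algebra L Lt] [IsScalarTower K L Lt] [IsNormalClosure K L Lt] :
    -- (a)
    (∀ I : P.OpenHopfIdeal, ∃ _ : Module.Finite K (I.fixedAlgebra L),
      (∃ b : Module.Basis (I.fixedAlgebra L →ₐ[K] Lt) Lt (I.fixedAlgebra L →ₗ[K] Lt),
        ∀ φ, b φ = φ.toLinearMap) ∧
      (letI := HopfGalois.homCoalgebra K (I.fixedAlgebra L) Lt
        ∀ f : I.fixedAlgebra L →ₗ[K] Lt, IsGroupLikeElem Lt f ↔
          ∃ φ : I.fixedAlgebra L →ₐ[K] Lt, f = φ.toLinearMap)) ∧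
    -- (b)
    (∀ I : P.OpenHopfIdeal, Finite (P.groupN Lt I) ∧
      ∃ e : MonoidAlgebra Lt (P.groupN Lt I) ≃ₐc[Lt] Lt ⊗[K] I.Quot,
        ∀ n : P.groupN Lt I, e (MonoidAlgebra.of Lt _ n) = n.val) ∧
    -- (c)
    (∀ I J : P.OpenHopfIdeal, ∃ M : P.OpenHopfIdeal, M ≤ I ∧ M ≤ J) ∧
    (∀ (I : P.OpenHopfIdeal) (hI : I ≤ I),
      HopfGalois.ProartinianHopf.groupNMap Lt hI = MonoidHom.id _) ∧
    (∀ (I J M : P.OpenHopfIdeal) (hIJ : I ≤ J) (hJM : J ≤ M) (hIM : I ≤ M),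
      HopfGalois.ProartinianHopf.groupNMap Lt hIM =
        (HopfGalois.ProartinianHopf.groupNMap Lt hJM).comp
          (HopfGalois.ProartinianHopf.groupNMap Lt hIJ)) ∧
    (∃ (_ : IsTopologicalGroup (P.LimN Lt)) (_ : CompactSpace (P.LimN Lt)),
      T2Space (P.LimN Lt) ∧ TotallyDisconnectedSpace (P.LimN Lt) ∧
      -- (d)
      (∃ e : HopfGalois.CompletedGroupAlgebra Lt (P.LimN Lt) ≃ₐ[Lt] P.CompletedTensor Lt,
        (HopfGalois.completedGroupAlgebra Lt (P.LimN Lt)).IsMorphism (P.completedTensor Lt)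
          e.toLinearMap ∧
        (P.completedTensor Lt).IsMorphism (HopfGalois.completedGroupAlgebra Lt (P.LimN Lt))
          e.symm.toLinearMap ∧
        ∀ n : P.LimN Lt, e (HopfGalois.CompletedGroupAlgebra.of n) =
          HopfGalois.ProartinianHopf.LimN.toCompletedTensor n)) ∧
    ∃ _ : MulDistribMulAction Gal(Lt/K) (P.LimN Lt),
      ContinuousSMul Gal(Lt/K) (P.LimN Lt) ∧
      (∀ (g : Gal(Lt/K)) (n : P.LimN Lt) (I : P.OpenHopfIdeal),
        (HopfGalois.ProartinianHopf.LimN.π I (g • n)).val =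
          Algebra.TensorProduct.map (g : Lt →ₐ[K] Lt) (AlgHom.id K I.Quot)
            (HopfGalois.ProartinianHopf.LimN.π I n).val) ∧
      -- (e)
      ∃ β : P.LimN Lt ≃ₜ
          Gal(Lt/K) ⧸ (IsScalarTower.toAlgHom K L Lt).fieldRange.fixingSubgroup,
        (∀ (n : P.LimN Lt) (g : Gal(Lt/K)), β n = g ↔
          ∀ x : L, P.can L Lt (HopfGalois.ProartinianHopf.LimN.toCompletedTensor n) x =
            g (algebraMap L Lt x)) ∧
        -- (f)
        (∃ _ : MulAction (P.LimN Lt)ᵐᵒᵖ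
            (Gal(Lt/K) ⧸ (IsScalarTower.toAlgHom K L Lt).fieldRange.fixingSubgroup),
          ContinuousSMul (P.LimN Lt)ᵐᵒᵖ
            (Gal(Lt/K) ⧸ (IsScalarTower.toAlgHom K L Lt).fieldRange.fixingSubgroup) ∧
          (∀ (h g : Gal(Lt/K)) (n : P.LimN Lt),
            MulOpposite.op n • (h : Gal(Lt/K) ⧸
              (IsScalarTower.toAlgHom K L Lt).fieldRange.fixingSubgroup) = g ↔
            ∀ x : L, P.homAct ((h : Lt →ₐ[K] Lt).comp (IsScalarTower.toAlgHom K L Lt)).toLinearMap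
              (HopfGalois.ProartinianHopf.LimN.toCompletedTensor n) x =
                g (algebraMap L Lt x)) ∧
          (∀ (g h : Gal(Lt/K)) (n : P.LimN Lt),
            g • (MulOpposite.op n • (h : Gal(Lt/K) ⧸
              (IsScalarTower.toAlgHom K L Lt).fieldRange.fixingSubgroup)) =
            MulOpposite.op (g • n) • ((g * h : Gal(Lt/K)) : Gal(Lt/K) ⧸
              (IsScalarTower.toAlgHom K L Lt).fieldRange.fixingSubgroup)) ∧
          (∀ m n : P.LimN Lt, β (m * n) = MulOpposite.op n • β m) ∧
          (∀ n : P.LimN Lt, β n = MulOpposite.op n • ((1 : Gal(Lt/K)) : Gal(Lt/K) ⧸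
              (IsScalarTower.toAlgHom K L Lt).fieldRange.fixingSubgroup))) ∧
        -- (g)
        ∀ I : P.OpenHopfIdeal, ∃ (V : Subgroup (P.LimN Lt)) (_ : V.Normal),
          IsOpen (V : Set (P.LimN Lt)) ∧
          (∃ e : P.LimN Lt ⧸ V ≃* P.groupN Lt I,
            ∀ n : P.LimN Lt, e n = HopfGalois.ProartinianHopf.LimN.π I n) ∧
          ∃ e : MonoidAlgebra Lt (P.LimN Lt ⧸ V) ≃ₐc[Lt] Lt ⊗[K] I.Quot,
            ∀ n : P.LimN Lt, e (MonoidAlgebra.of Lt _ (n : P.LimN Lt ⧸ V)) =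
              (HopfGalois.ProartinianHopf.LimN.π I n).val := by
  have hG : P.IsHopfGalois L := inferInstance
  have hgal := HopfGalois.ProartinianHopf.isGalois_of_isNormalClosure K L Lt
  have hfin := fun I : P.OpenHopfIdeal =>
    HopfGalois.ProartinianHopf.finite_groupN (F := Lt) I
  have hcomp := HopfGalois.ProartinianHopf.LimN.compactSpace hfin
  have hsurj := fun I : P.OpenHopfIdeal =>
    HopfGalois.ProartinianHopf.LimN.π_surjective (F := Lt) I hG
  have hequiv := fun I : P.OpenHopfIdeal =>
    HopfGalois.ProartinianHopf.exists_groupAlgebra_equiv Lt I hG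
  have hquot := fun I : P.OpenHopfIdeal =>
    HopfGalois.ProartinianHopf.exists_quotient_groupAlgebra_equiv I (hsurj I) (hequiv I)
  refine ⟨fun I => ⟨I.finite_fixedAlgebra L, I.exists_basis_fixedAlgebra L Lt, fun f => ?_⟩,
    fun I => ⟨hfin I, hequiv I⟩, HopfGalois.ProartinianHopf.OpenHopfIdeal.exists_le_le,
    fun I hI => ?_, fun I J M hIJ hJM hIM => ?_, ⟨inferInstance, hcomp, inferInstance,
      inferInstance, ?_⟩, ?_⟩
  · have := I.finite_fixedAlgebra L
    exact HopfGalois.isGroupLikeElem_hom_iff f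
  -- Functoriality of $I \mapsto N_I$ is checked on components of elements of $N$, which exhaust
  -- each $N_I$.
  · ext n
    obtain ⟨n, rfl⟩ := hsurj I n
    rw [HopfGalois.ProartinianHopf.LimN.groupNMap_π]
    rfl
  · ext n
    obtain ⟨n, rfl⟩ := hsurj I n
    rw [MonoidHom.comp_apply, HopfGalois.ProartinianHopf.LimN.groupNMap_π,
      HopfGalois.ProartinianHopf.LimN.groupNMap_π, HopfGalois.ProartinianHopf.LimN.groupNMap_π]
  · choose e he using hquot
    exact HopfGalois.ProartinianHopf.exists_completedGroupAlgebra_equiv e he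
  set σ := IsScalarTower.toAlgHom K L Lt
  have hgl := fun (g : Gal(Lt/K)) (n : P.LimN Lt) (I : P.OpenHopfIdeal) =>
    HopfGalois.ProartinianHopf.isGroupLikeElem_mapCoeff hG σ (g : Lt →ₐ[K] Lt) n I
  obtain ⟨δ, hδ⟩ := HopfGalois.ProartinianHopf.exists_quotient_equiv_algHom σ
  obtain ⟨β, hβ⟩ := HopfGalois.ProartinianHopf.exists_homeomorph (P := P) σ δ hδ
  have hext : ∀ (φ : L →ₐ[K] Lt) (n : P.LimN Lt) (g : Gal(Lt/K)),
      HopfGalois.ProartinianHopf.algHomAct φ n = (g : Lt →ₐ[K] Lt).comp σ ↔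
        ∀ x : L, P.homAct φ.toLinearMap
          (HopfGalois.ProartinianHopf.LimN.toCompletedTensor n) x = g (algebraMap L Lt x) := by
    intro φ n g
    rw [← HopfGalois.ProartinianHopf.algHomAct_toLinearMap]
    exact AlgHom.ext_iff
  let _ := HopfGalois.ProartinianHopf.galoisAction hgl
  let _ := HopfGalois.ProartinianHopf.cosetAction (P := P) δ
  have hact : ∀ (n : P.LimN Lt) (q : Gal(Lt/K) ⧸ σ.fieldRange.fixingSubgroup),
      δ (MulOpposite.op n • q) = HopfGalois.ProartinianHopf.algHomAct (δ q) n :=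
    fun n q => δ.apply_symm_apply _
  -- Through $\delta$, every statement about cosets becomes one about embeddings, where $\beta(m)$
  -- is $\sigma \cdot m$.
  have hmul : ∀ m n : P.LimN Lt, β (m * n) = MulOpposite.op n • β m := fun m n => by
    apply δ.injective
    rw [hact, hβ, hβ, HopfGalois.ProartinianHopf.algHomAct_mul]
  refine ⟨inferInstance, HopfGalois.ProartinianHopf.continuousSMul_galoisAction hgl,
    HopfGalois.ProartinianHopf.galoisAction_π hgl, β, fun n g => ?_,
    ⟨inferInstance, ⟨?_⟩, fun h g n => ?_, fun g h n => ?_, hmul, fun n => ?_⟩, fun I => ?_⟩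
  · rw [← δ.injective.eq_iff, hβ, hδ]
    exact hext σ n g
  -- Under $\beta$ the action on cosets is right translation of $N$ on itself, so its continuity is
  -- that of multiplication.
  · have e : (fun p : (P.LimN Lt)ᵐᵒᵖ × (Gal(Lt/K) ⧸ σ.fieldRange.fixingSubgroup) =>
        p.1 • p.2) = fun p => β (β.symm p.2 * p.1.unop) := by
      ext1 p
      rw [hmul, β.apply_symm_apply]
      rfl
    rw [e]
    exact β.continuous.comp ((β.symm.continuous.comp continuous_snd).mul
      (MulOpposite.continuous_unop.comp continuous_fst))
  · rw [← δ.injective.eq_iff, hact, hδ, hδ]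
    exact hext _ n g
  · have hg : ∀ q : Gal(Lt/K) ⧸ σ.fieldRange.fixingSubgroup,
        δ (g • q) = (g : Lt →ₐ[K] Lt).comp (δ q) := by
      intro q
      obtain ⟨k, rfl⟩ := QuotientGroup.mk_surjective q
      have h1 : g • (k : Gal(Lt/K) ⧸ σ.fieldRange.fixingSubgroup) = ((g * k : Gal(Lt/K)) : _) := rfl
      rw [h1, hδ, hδ]
      rfl
    have h1 : ((g * h : Gal(Lt/K)) : Gal(Lt/K) ⧸ σ.fieldRange.fixingSubgroup) =
        g • (h : Gal(Lt/K) ⧸ σ.fieldRange.fixingSubgroup) := rfl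
    apply δ.injective
    rw [h1, hact, hg, hg, hact]
    exact (HopfGalois.ProartinianHopf.algHomAct_galoisAction hgl g n _).symm
  · apply δ.injective
    rw [hact, hβ, hδ]
    rfl
  · exact ⟨(HopfGalois.ProartinianHopf.LimN.π I).ker, inferInstance,
      HopfGalois.ProartinianHopf.LimN.isOpen_π_eq (E := Lt) I 1,
      ⟨QuotientGroup.quotientKerEquivOfSurjective _ (hsurj I), fun n => rfl⟩, hquot I⟩
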